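/- Consider a Gaussian MIMO broadcast channel (BC) with $K$ users: user $i$ receives $y_i = H_i x + z_i$, where $H_i$ is a complex $N_r\times N_t$ matrix and $z_i$ is complex Gaussian noise with identity covariance matrix. With dirty paper coding and an encoding order $\pi$ ($\pi(i)$ is the position at which user $i$ is encoded), positive semidefinite transmit covariance matrices $Q_1,\dots,Q_K$ give user $i$ the rate \[ r_i=\log\frac{\big|I+H_i\big(\sum_{k:\pi(k)\ge\pi(i)}Q_k\big)H_i^H\big|}{\big|I+H_i\big(\sum_{k:\pi(k)>\pi(i)}Q_k\big)H_i^H\big|}, \] and the transmit covariance matrix is $Q=\sum_{i=1}^K Q_i$. Let $w_1,\dots,w_K>0$ be user weights, let $A_1,A_2$ be positive semidefinite Hermitian $N_t\times N_t$ matrices, and let $P_1,P_2>0$. Let $V$ be the optimal weighted sum rate of the BC under two linear constraints, that is, the supremum of $\sum_{i=1}^K w_ir_i$ over all $Q_1,\dots,Q_K\ge 0$ and all encoding orders, subject to \[ \operatorname{tr}(QA_1)\le P_1,\qquad \operatorname{tr}(QA_2)\le P_2 . \] For $\lambda_1,\lambda_2\ge 0$ let $g(\lambda_1,\lambda_2)$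 be the supremum of $\sum_{i=1}^K w_ir_i$, again over all $Q_1,\dots,Q_K\ge0$ and all encoding orders, subject to the single constraint \[ \lambda_1\operatorname{tr}(QA_1)+\lambda_2\operatorname{tr}(QA_2)\le\lambda_1P_1+\lambda_2P_2 . \] (An unbounded supremum has the value $+\infty$.) Then \[ V=\min_{\lambda_1\ge 0,\ \lambda_2\ge 0} g(\lambda_1,\lambda_2), \] where the minimum is attained, and $V$ is a maximum whenever it is finite. The same holds when, in both optimization problems, the encoding order is fixed to be any order in which the weights are nonincreasing, e.g. the order $1,2,\dots,K$ if $w_1\ge w_2\ge\dots\ge w_K$. -/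

import Mathlib

open scoped ComplexOrder

noncomputable section

/-- The rate of user `i` in the Gaussian MIMO broadcast channel `y i = H i * x + z i`, where the noise
`z i` has identity covariance, under dirty paper coding with encoding order `π` and transmit
covariance matrices `Q k = E(x k * (x k)ᴴ)`. Here `π i` is the position at which user `i` is encoded;
user `i` suffers interference only from the users encoded after it. For `π = 1` the users are encoded
in the order of their indices. Both determinants are real and at least `1` when all `Q k` are
positive semidefinite. -/
def dpcRate {K Nt Nr : ℕ} (H : Fin K → Matrix (Fin Nr) (Fin Nt) ℂ) (π : Equiv.Perm (Fin K))
    (Q : Fin K → Matrix (Fin Nt) (Fin Nt) ℂ) (i : Fin K) : ℝ :=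
  Real.log
    ((1 + H i * (∑ k with π i ≤ π k, Q k) * (H i).conjTranspose).det.re /
      (1 + H i * (∑ k with π i < π k, Q k) * (H i).conjTranspose).det.re)

/-- The weighted sum rate `∑ i, w i * r i`. -/
def weightedSumRate {K Nt Nr : ℕ} (H : Fin K → Matrix (Fin Nr) (Fin Nt) ℂ) (w : Fin K → ℝ)
    (π : Equiv.Perm (Fin K)) (Q : Fin K → Matrix (Fin Nt) (Fin Nt) ℂ) : ℝ :=
  ∑ i, w i * dpcRate H π Q i

/-- The tuples of transmit covariance matrices whose sum, the transmit covariance matrix of the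
base station, lies in `C`. -/
def feasible {Nt : ℕ} (K : ℕ) (C : Set (Matrix (Fin Nt) (Fin Nt) ℂ)) :
    Set (Fin K → Matrix (Fin Nt) (Fin Nt) ℂ) :=
  {Q | (∀ i, (Q i).PosSemidef) ∧ ∑ i, Q i ∈ C}

/-- The two linear constraints `tr (Q * A₁) ≤ P₁` and `tr (Q * A₂) ≤ P₂`. -/
def twoConstraints {Nt : ℕ} (A₁ A₂ : Matrix (Fin Nt) (Fin Nt) ℂ) (P₁ P₂ : ℝ) :
    Set (Matrix (Fin Nt) (Fin Nt) ℂ) :=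
  {Q | (Q * A₁).trace.re ≤ P₁ ∧ (Q * A₂).trace.re ≤ P₂}

/-- The aggregated constraint `l₁ * tr (Q * A₁) + l₂ * tr (Q * A₂) ≤ l₁ * P₁ + l₂ * P₂`. -/
def aggregatedConstraint {Nt : ℕ} (A₁ A₂ : Matrix (Fin Nt) (Fin Nt) ℂ) (P₁ P₂ l₁ l₂ : ℝ) :
    Set (Matrix (Fin Nt) (Fin Nt) ℂ) :=
  {Q | l₁ * (Q * A₁).trace.re + l₂ * (Q * A₂).trace.re ≤ l₁ * P₁ + l₂ * P₂}

/-- The optimal weighted sum rate for the encoding order `π` under the transmit covariance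
constraint `C`, with value `⊤` if the weighted sum rate is unbounded. -/
def orderOptimum {K Nt Nr : ℕ} (H : Fin K → Matrix (Fin Nr) (Fin Nt) ℂ) (w : Fin K → ℝ)
    (π : Equiv.Perm (Fin K)) (C : Set (Matrix (Fin Nt) (Fin Nt) ℂ)) : EReal :=
  ⨆ Q ∈ feasible K C, (weightedSumRate H w π Q : EReal)

/-- The optimal weighted sum rate of the broadcast channel under the transmit covariance
constraint `C`: the optimum over all transmit covariance matrices and all encoding orders. -/
def bcOptimum {K Nt Nr : ℕ} (H : Fin K → Matrix (Fin Nr) (Fin Nt) ℂ) (w : Fin K → ℝ)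
    (C : Set (Matrix (Fin Nt) (Fin Nt) ℂ)) : EReal :=
  ⨆ π : Equiv.Perm (Fin K), orderOptimum H w π C

end

/-! Aggregating the constraints only enlarges the feasible set, so `V ≤ g` is immediate; the content
is a pair of multipliers without a gap. The weighted sum rate is not concave in the broadcast
covariances, so convex duality does not apply directly. Instead, for an order with nonincreasing
weights, every first-order stationary point is a global maximizer of the Lagrangian, as becomes
visible in the dual multiple access channel (MAC).

Suppose first that the constraints bound the power. A maximizer `Q` exists by compactness and also
maximizes the linearized rate over the convex feasible set. Separation then gives multipliers for
which `Q` is stationary with `A = l₁ A₁ + l₂ A₂` and satisfies complementary slackness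
(`exists_isRateStationary_of_posDef_add`). For positive definite `A`, the matrices `w k (S k⁻¹ - R
k⁻¹)`, with `S k` the interference and `R k` the signal covariance, have the same rates and the same
total power in the MAC with noise covariance `A`, and they inherit the optimality conditions
(`macRate_eq`, `sum_trace_dualCov`, `one_sub_macGradient`). There the weighted sum rate is concave,
so they are globally optimal. For any other order, a maximizer of the Lagrangian is itself
stationary and maps to the MAC with equal value; submodularity of the log-determinant makes the
order of nonincreasing weights best there. Hence `Q` maximizes the Lagrangian over all covariances
and orders (`IsRateStationary.lagrangian_le`), and is optimal under the aggregated constraint.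

Singular matrices are handled by projection onto a support. If some direction in the kernel of `A₁ +
A₂` reaches a user, then `V = ⊤`; otherwise that kernel can be projected away without changing any
rate. -/

namespace Matrix

/-! ### Positive semidefinite matrices and traces -/

variable {m n : Type*} [Fintype m] [Fintype n]

theorem PosSemidef.exists_eq_conjTranspose_mul_self {A : Matrix n n ℂ} (hA : A.PosSemidef) :
    ∃ X : Matrix n n ℂ, A = Xᴴ * X := by
  open scoped MatrixOrder in
  classical
  exact CStarAlgebra.nonneg_iff_eq_star_mul_self.mp hA.nonneg

theorem PosSemidef.re_trace_nonneg {A : Matrix n n ℂ} (hA : A.PosSemidef) : 0 ≤ A.trace.re :=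
  (Complex.le_def.mp hA.trace_nonneg).1

theorem PosSemidef.re_trace_mul_nonneg {A B : Matrix n n ℂ} (hA : A.PosSemidef)
    (hB : B.PosSemidef) : 0 ≤ (A * B).trace.re := by
  obtain ⟨Y, rfl⟩ := hB.exists_eq_conjTranspose_mul_self
  rw [← Matrix.mul_assoc, trace_mul_comm, ← Matrix.mul_assoc]
  exact (hA.mul_mul_conjTranspose_same Y).re_trace_nonneg

theorem PosSemidef.mul_eq_zero_of_re_trace_le {A B : Matrix n n ℂ} (hA : A.PosSemidef)
    (hB : B.PosSemidef) (h : (A * B).trace.re ≤ 0) : A * B = 0 := by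
  have h0 : (A * B).trace.re = 0 := le_antisymm h (hA.re_trace_mul_nonneg hB)
  obtain ⟨X, rfl⟩ := hA.exists_eq_conjTranspose_mul_self
  obtain ⟨Y, rfl⟩ := hB.exists_eq_conjTranspose_mul_self
  have e : (Xᴴ * X * (Yᴴ * Y)).trace = ((X * Yᴴ)ᴴ * (X * Yᴴ)).trace := by
    rw [← Matrix.mul_assoc, trace_mul_comm, conjTranspose_mul, conjTranspose_conjTranspose]
    simp only [Matrix.mul_assoc]
  have hp := posSemidef_conjTranspose_mul_self (X * Yᴴ)
  have h1 : ((X * Yᴴ)ᴴ * (X * Yᴴ)).trace = 0 := by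
    have h2 := Complex.le_def.mp hp.trace_nonneg
    apply Complex.ext
    · rw [← e, h0]; rfl
    · exact h2.2.symm
  have h3 := trace_conjTranspose_mul_self_eq_zero_iff.mp h1
  calc Xᴴ * X * (Yᴴ * Y) = Xᴴ * (X * Yᴴ) * Y := by simp only [Matrix.mul_assoc]
    _ = 0 := by rw [h3]; simp

theorem posSemidef_of_re_dotProduct_nonneg {A : Matrix n n ℂ} (hA : A.IsHermitian)
    (h : ∀ x : n → ℂ, 0 ≤ (star x ⬝ᵥ (A *ᵥ x)).re) : A.PosSemidef := by
  refine .of_dotProduct_mulVec_nonneg hA fun x => ?_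
  refine Complex.le_def.mpr ⟨h x, ?_⟩
  have := hA.im_star_dotProduct_mulVec_self x
  simpa using this.symm

theorem dotProduct_mulVec_eq_trace (A : Matrix n n ℂ) (x : n → ℂ) :
    star x ⬝ᵥ (A *ᵥ x) = (A * vecMulVec x (star x)).trace := by
  rw [mul_vecMulVec, trace_vecMulVec, dotProduct_comm]

/-! ### Log-determinants, the Loewner order and support projections -/

variable [DecidableEq m] [DecidableEq n]

/-- The real logarithm of the determinant. -/
noncomputable def logDet (M : Matrix n n ℂ) : ℝ := Real.log M.det.re

theorem PosDef.det_re_pos {M : Matrix n n ℂ} (hM : M.PosDef) : 0 < M.det.re :=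
  (Complex.lt_def.mp hM.det_pos).1

theorem PosDef.det_eq_re {M : Matrix n n ℂ} (hM : M.PosDef) : M.det = (M.det.re : ℂ) :=
  Complex.ext rfl (Complex.lt_def.mp hM.det_pos).2.symm

theorem PosDef.isUnit_det {M : Matrix n n ℂ} (hM : M.PosDef) : IsUnit M.det :=
  (isUnit_iff_isUnit_det M).mp hM.isUnit

theorem PosDef.exists_eq_conjTranspose_mul_self {A : Matrix n n ℂ} (hA : A.PosDef) :
    ∃ X : Matrix n n ℂ, IsUnit X.det ∧ A = Xᴴ * X := by
  obtain ⟨X, rfl⟩ := hA.posSemidef.exists_eq_conjTranspose_mul_self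
  have := hA.isUnit_det
  rw [det_mul] at this
  exact ⟨X, isUnit_of_mul_isUnit_right this, rfl⟩

theorem PosDef.logDet_le_trace_sub_card {M : Matrix n n ℂ} (hM : M.PosDef) :
    logDet M ≤ M.trace.re - Fintype.card n := by
  have h1 : M.det.re = ∏ i, hM.1.eigenvalues i := by
    rw [hM.1.det_eq_prod_eigenvalues]
    norm_cast
  have h2 : M.trace.re = ∑ i, hM.1.eigenvalues i := by
    rw [hM.1.trace_eq_sum_eigenvalues]
    norm_cast
  rw [logDet, h1, h2, Real.log_prod (fun i _ => (hM.eigenvalues_pos i).ne')]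
  have : (Fintype.card n : ℝ) = ∑ _i : n, (1 : ℝ) := by simp
  rw [this, ← Finset.sum_sub_distrib]
  exact Finset.sum_le_sum fun i _ => Real.log_le_sub_one_of_pos (hM.eigenvalues_pos i)

/-- The log-determinant lies below its tangents. -/
theorem PosDef.logDet_le {Y C : Matrix n n ℂ} (hY : Y.PosDef) (hC : C.PosDef) :
    logDet Y ≤ logDet C + (C⁻¹ * (Y - C)).trace.re := by
  obtain ⟨X, hX, rfl⟩ := hC.exists_eq_conjTranspose_mul_self
  have hXu : IsUnit X := (isUnit_iff_isUnit_det X).mpr hX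
  have hXH : IsUnit Xᴴ.det := by rw [det_conjTranspose]; exact hX.star
  -- Whitening by `C` moves the base point to the identity, where the bound is `log x ≤ x - 1`
  -- summed over eigenvalues.
  have hM : (X⁻¹ᴴ * Y * X⁻¹).PosDef := by
    refine hY.conjTranspose_mul_mul_same ?_
    exact mulVec_injective_of_isUnit (by simpa using hXu)
  have h := hM.logDet_le_trace_sub_card
  have hYe : Y = Xᴴ * (X⁻¹ᴴ * Y * X⁻¹) * X := by
    rw [conjTranspose_nonsing_inv]
    simp only [Matrix.mul_assoc, nonsing_inv_mul _ hX, Matrix.mul_one]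
    rw [← Matrix.mul_assoc, mul_nonsing_inv _ hXH, Matrix.one_mul]
  have hdet : Y.det.re = (X⁻¹ᴴ * Y * X⁻¹).det.re * (Xᴴ * X).det.re := by
    have : Y.det = (X⁻¹ᴴ * Y * X⁻¹).det * (Xᴴ * X).det := by
      conv_lhs => rw [hYe]
      simp only [det_mul]; ring
    rw [this, hM.det_eq_re, hC.det_eq_re]
    norm_cast
  have hlog : logDet Y = logDet (X⁻¹ᴴ * Y * X⁻¹) + logDet (Xᴴ * X) := by
    rw [logDet, hdet, Real.log_mul hM.det_re_pos.ne' hC.det_re_pos.ne']; rfl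
  have htr : ((Xᴴ * X)⁻¹ * (Y - Xᴴ * X)).trace.re
      = (X⁻¹ᴴ * Y * X⁻¹).trace.re - Fintype.card n := by
    rw [Matrix.mul_sub, nonsing_inv_mul _ hC.isUnit_det, trace_sub, trace_one, mul_inv_rev,
      Matrix.mul_assoc, trace_mul_comm, conjTranspose_nonsing_inv]
    simp
  rw [hlog, htr]; linarith

theorem PosDef.logDet_mono {Y C : Matrix n n ℂ} (hY : Y.PosDef) (hC : C.PosDef)
    (h : (C - Y).PosSemidef) : logDet Y ≤ logDet C := by
  have h1 := hY.logDet_le hC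
  have h2 := hC.inv.posSemidef.re_trace_mul_nonneg h
  have : (C⁻¹ * (Y - C)).trace.re = -(C⁻¹ * (C - Y)).trace.re := by
    rw [← neg_sub C Y, Matrix.mul_neg, trace_neg]; rfl
  linarith

/-- Both conditions are Schur complement criteria for the same block matrix with diagonal blocks
`R`, `B` and off-diagonal block `H`. This carries dual feasibility from the broadcast channel to the
MAC. -/
theorem PosDef.sub_posSemidef_swap {B : Matrix n n ℂ} {R : Matrix m m ℂ} (hB : B.PosDef)
    (hR : R.PosDef) {H : Matrix m n ℂ} (h : (B - Hᴴ * R⁻¹ * H).PosSemidef) :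
    (R - H * B⁻¹ * Hᴴ).PosSemidef := by
  have := hB.isUnit.invertible
  have := hR.isUnit.invertible
  have h1 := (PosDef.fromBlocks₁₁ (A := R) H B hR).mpr h
  exact (PosDef.fromBlocks₂₂ R H hB).mp h1

theorem PosDef.inv_sub_inv_posSemidef {Y C : Matrix n n ℂ} (hY : Y.PosDef) (hC : C.PosDef)
    (h : (C - Y).PosSemidef) : (Y⁻¹ - C⁻¹).PosSemidef := by
  have := hC.sub_posSemidef_swap (R := Y⁻¹) (H := 1) hY.inv
    (by simpa [nonsing_inv_nonsing_inv _ hY.isUnit_det] using h)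
  simpa using this

theorem logDet_add_conjTranspose_mul {B : Matrix n n ℂ} (hB : B.PosDef) (Y : Matrix m n ℂ) :
    logDet (B + Yᴴ * Y) = logDet B + logDet (1 + Y * B⁻¹ * Yᴴ) := by
  have hp : (1 + Y * B⁻¹ * Yᴴ).PosDef :=
    PosDef.one.add_posSemidef (hB.inv.posSemidef.mul_mul_conjTranspose_same Y)
  have h : (B + Yᴴ * Y).det = B.det * (1 + Y * B⁻¹ * Yᴴ).det := by
    rw [det_add_mul Yᴴ Y hB.isUnit_det]
  rw [logDet, h, hB.det_eq_re, hp.det_eq_re]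
  norm_cast
  rw [Real.log_mul hB.det_re_pos.ne' hp.det_re_pos.ne']; rfl

/-- Log-determinant increments decrease as the base matrix grows. -/
theorem PosDef.logDet_add_sub_antitone {B C M : Matrix n n ℂ} (hB : B.PosDef) (hC : C.PosDef)
    (h : (C - B).PosSemidef) (hM : M.PosSemidef) :
    logDet (C + M) - logDet C ≤ logDet (B + M) - logDet B := by
  -- The determinant lemma turns an increment into `logDet (1 + Y * B⁻¹ * Yᴴ)`, and inversion
  -- reverses the Loewner order.
  obtain ⟨Y, rfl⟩ := hM.exists_eq_conjTranspose_mul_self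
  rw [logDet_add_conjTranspose_mul hB, logDet_add_conjTranspose_mul hC]
  have h1 := (hB.inv_sub_inv_posSemidef hC h).mul_mul_conjTranspose_same Y
  have h2 : logDet (1 + Y * C⁻¹ * Yᴴ) ≤ logDet (1 + Y * B⁻¹ * Yᴴ) := by
    refine PosDef.logDet_mono
      (PosDef.one.add_posSemidef (hC.inv.posSemidef.mul_mul_conjTranspose_same Y))
      (PosDef.one.add_posSemidef (hB.inv.posSemidef.mul_mul_conjTranspose_same Y)) ?_
    convert h1 using 1
    simp only [Matrix.mul_sub, Matrix.sub_mul]; abel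
  linarith

theorem PosSemidef.smul_trace_sub_posSemidef {M : Matrix n n ℂ} (hM : M.PosSemidef) :
    ((M.trace.re : ℂ) • (1 : Matrix n n ℂ) - M).PosSemidef := by
  have htr : M.trace.re = ∑ i, hM.1.eigenvalues i := by
    rw [hM.1.trace_eq_sum_eigenvalues]
    norm_cast
  have hU : IsUnit (hM.1.eigenvectorUnitary : Matrix n n ℂ) := Unitary.isUnit_coe
  have e : (M.trace.re : ℂ) • (1 : Matrix n n ℂ) - M =
      Unitary.conjStarAlgAut ℂ _ hM.1.eigenvectorUnitary
        (diagonal fun i => ((M.trace.re - hM.1.eigenvalues i : ℝ) : ℂ)) := by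
    have : (diagonal fun i => ((M.trace.re - hM.1.eigenvalues i : ℝ) : ℂ)) =
        (M.trace.re : ℂ) • (1 : Matrix n n ℂ) -
          diagonal (RCLike.ofReal ∘ hM.1.eigenvalues) := by
      rw [smul_one_eq_diagonal, diagonal_sub]
      congr 1; ext i; simp
    rw [this, map_sub, map_smul, map_one, ← hM.1.spectral_theorem]
  rw [e, Unitary.conjStarAlgAut_apply, Matrix.IsUnit.posSemidef_star_right_conjugate_iff hU]
  refine PosSemidef.diagonal fun i => ?_
  have : hM.1.eigenvalues i ≤ M.trace.re := by
    rw [htr]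
    exact Finset.single_le_sum (f := hM.1.eigenvalues) (fun j _ => hM.eigenvalues_nonneg j)
      (Finset.mem_univ i)
  have h2 : (0 : ℝ) ≤ M.trace.re - hM.1.eigenvalues i := by linarith
  exact Complex.zero_le_real.mpr h2

/-- The constant is the trace of `M` after whitening by `A`. It makes `tr (Q * A)` control every
other linear measure of power. -/
theorem PosDef.exists_smul_sub_posSemidef {A M : Matrix n n ℂ} (hA : A.PosDef)
    (hM : M.PosSemidef) : ∃ c : ℝ, 0 ≤ c ∧ ((c : ℂ) • A - M).PosSemidef := by
  obtain ⟨X, hX, rfl⟩ := hA.exists_eq_conjTranspose_mul_self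
  have hXH : IsUnit Xᴴ.det := by rw [det_conjTranspose]; exact hX.star
  have hN : (X⁻¹ᴴ * M * X⁻¹).PosSemidef := hM.conjTranspose_mul_mul_same _
  refine ⟨_, hN.re_trace_nonneg, ?_⟩
  have h := hN.smul_trace_sub_posSemidef.conjTranspose_mul_mul_same X
  convert h using 1
  rw [Matrix.mul_sub, Matrix.sub_mul, Matrix.mul_smul, Matrix.smul_mul, Matrix.mul_one]
  congr 1
  rw [conjTranspose_nonsing_inv]
  simp only [Matrix.mul_assoc, nonsing_inv_mul _ hX, Matrix.mul_one]
  rw [← Matrix.mul_assoc, mul_nonsing_inv _ hXH, Matrix.one_mul]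

/-- The orthogonal projection onto the range of a positive semidefinite matrix. -/
theorem PosSemidef.exists_support_projection {A : Matrix n n ℂ} (hA : A.PosSemidef) :
    ∃ p : Matrix n n ℂ, p.IsHermitian ∧ p * p = p ∧ A * p = A ∧ (1 - p).PosSemidef ∧
      (A + (1 - p)).PosDef := by
  set φ := Unitary.conjStarAlgAut ℂ (Matrix n n ℂ) hA.1.eigenvectorUnitary with hφ
  set ev := hA.1.eigenvalues with hev
  have hU : IsUnit (hA.1.eigenvectorUnitary : Matrix n n ℂ) := Unitary.isUnit_coe
  have hs : A = φ (diagonal (RCLike.ofReal ∘ ev)) := hA.1.spectral_theorem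
  set d : n → ℂ := fun i => if ev i = 0 then 0 else 1 with hd
  have h1 : (1 : Matrix n n ℂ) - φ (diagonal d) = φ (diagonal fun i => 1 - d i) := by
    rw [← diagonal_sub, map_sub, ← map_one φ]; simp
  refine ⟨φ (diagonal d), ?_, ?_, ?_, ?_, ?_⟩
  · have : star (diagonal d) = diagonal d := by
      rw [star_eq_conjTranspose, diagonal_conjTranspose]
      congr 1; ext i; simp only [hd, Pi.star_apply]; split_ifs <;> simp
    rw [IsHermitian, ← star_eq_conjTranspose, ← map_star, this]
  · rw [← map_mul, diagonal_mul_diagonal]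
    congr 2; ext i; simp only [hd]; split_ifs <;> simp
  · conv_lhs => rw [hs]
    conv_rhs => rw [hs]
    rw [← map_mul, diagonal_mul_diagonal]
    congr 2; ext i; simp only [hd, Function.comp]; split_ifs with h <;> simp [h]
  · rw [h1, hφ, Unitary.conjStarAlgAut_apply, Matrix.IsUnit.posSemidef_star_right_conjugate_iff hU]
    refine PosSemidef.diagonal fun i => ?_
    simp only [hd]; split_ifs <;> simp
  · rw [h1]
    conv => enter [1, 1]; rw [hs]
    rw [← map_add, diagonal_add, hφ, Unitary.conjStarAlgAut_apply,
      Matrix.IsUnit.posDef_star_right_conjugate_iff hU, posDef_diagonal_iff]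
    intro i
    simp only [hd, Function.comp]
    have h0 : 0 ≤ ev i := hA.eigenvalues_nonneg i
    split_ifs with h
    · simp [h]
    · simpa using lt_of_le_of_ne h0 (Ne.symm h)

theorem mul_eq_self_of_ker_le {A p : Matrix n n ℂ} {H : Matrix m n ℂ} (hp : A * p = A)
    (h : ∀ v : n → ℂ, A *ᵥ v = 0 → H *ᵥ v = 0) : H * p = H := by
  have h0 : H * (1 - p) = 0 := by
    refine ext_of_mulVec_single fun j => ?_
    rw [← mulVec_mulVec, zero_mulVec]
    apply h
    rw [mulVec_mulVec, Matrix.mul_sub, hp, Matrix.mul_one, sub_self, zero_mulVec]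
  rw [Matrix.mul_sub, Matrix.mul_one, sub_eq_zero] at h0
  exact h0.symm

/-! ### Algebra of one user's step in the broadcast-MAC duality -/

section DualStep

variable {B Q : Matrix n n ℂ} {R S : Matrix m m ℂ} {H : Matrix m n ℂ} {w : ℂ}

/-- The resolvent identity for `R = S + H * Q * Hᴴ`. -/
theorem inv_sub_inv_eq_mul (hS : IsUnit S.det) (hR : IsUnit R.det) (e : R = S + H * Q * Hᴴ) :
    S⁻¹ - R⁻¹ = S⁻¹ * (H * Q * Hᴴ) * R⁻¹ := by
  have : H * Q * Hᴴ = R - S := by rw [e]; abel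
  rw [this, Matrix.mul_sub, Matrix.sub_mul, nonsing_inv_mul _ hS, Matrix.one_mul,
    Matrix.mul_assoc, mul_nonsing_inv _ hR, Matrix.mul_one]

theorem inv_sub_inv_eq_mul' (hS : IsUnit S.det) (hR : IsUnit R.det) (e : R = S + H * Q * Hᴴ) :
    S⁻¹ - R⁻¹ = R⁻¹ * (H * Q * Hᴴ) * S⁻¹ := by
  have : H * Q * Hᴴ = R - S := by rw [e]; abel
  rw [this, Matrix.mul_sub, Matrix.sub_mul, nonsing_inv_mul _ hR, Matrix.one_mul,
    Matrix.mul_assoc, mul_nonsing_inv _ hS, Matrix.mul_one]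

/-- Here `B` is the MAC covariance before the user is added and `w • (S⁻¹ - R⁻¹)` the user's dual
covariance. Complementary slackness trades `w • (Hᴴ * R⁻¹ * H * Q)` for `B * Q`, so that `B` factors
out of the updated covariance. -/
theorem dual_step_eq_mul (hS : IsUnit S.det) (hR : IsUnit R.det) (e : R = S + H * Q * Hᴴ)
    (hE : (B - w • (Hᴴ * R⁻¹ * H)) * Q = 0) :
    B + Hᴴ * (w • (S⁻¹ - R⁻¹)) * H = B * (1 + Q * (Hᴴ * S⁻¹ * H)) := by
  have h1 : B * Q = w • (Hᴴ * R⁻¹ * H * Q) := by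
    rw [Matrix.sub_mul, sub_eq_zero] at hE
    rw [hE, Matrix.smul_mul]
  rw [inv_sub_inv_eq_mul' hS hR e, Matrix.mul_add, Matrix.mul_one, ← Matrix.mul_assoc B Q, h1]
  simp only [Matrix.mul_smul, Matrix.smul_mul, Matrix.mul_assoc]

theorem dual_step_det (hS : IsUnit S.det) (hR : IsUnit R.det) (e : R = S + H * Q * Hᴴ)
    (hE : (B - w • (Hᴴ * R⁻¹ * H)) * Q = 0) :
    (B + Hᴴ * (w • (S⁻¹ - R⁻¹)) * H).det * S.det = B.det * R.det := by
  rw [dual_step_eq_mul hS hR e hE, det_mul]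
  have h1 : (1 + Q * (Hᴴ * S⁻¹ * H)).det = (1 + S⁻¹ * (H * Q * Hᴴ)).det := by
    have : Q * (Hᴴ * S⁻¹ * H) = (Q * Hᴴ) * (S⁻¹ * H) := by simp only [Matrix.mul_assoc]
    rw [this, det_one_add_mul_comm]
    simp only [Matrix.mul_assoc]
  have h2 : R = S * (1 + S⁻¹ * (H * Q * Hᴴ)) := by
    rw [Matrix.mul_add, Matrix.mul_one, ← Matrix.mul_assoc, mul_nonsing_inv _ hS, Matrix.one_mul,
      ← e]
  rw [h1]
  conv_rhs => rw [h2, det_mul]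
  ring

/-- The transformation is symmetric: the broadcast covariance is recovered from the MAC covariances
by the same formula that defines the dual ones. -/
theorem dual_step_inv_sub_inv (hS : IsUnit S.det) (hR : IsUnit R.det) (e : R = S + H * Q * Hᴴ)
    (hE : (B - w • (Hᴴ * R⁻¹ * H)) * Q = 0) (hE' : Q * (B - w • (Hᴴ * R⁻¹ * H)) = 0)
    (hB : IsUnit B.det) (hB' : IsUnit (B + Hᴴ * (w • (S⁻¹ - R⁻¹)) * H).det) :
    w • (B⁻¹ - (B + Hᴴ * (w • (S⁻¹ - R⁻¹)) * H)⁻¹) = Q := by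
  have h := dual_step_eq_mul hS hR e hE
  set C := B + Hᴴ * (w • (S⁻¹ - R⁻¹)) * H with hC
  have h1 : B⁻¹ = (1 + Q * (Hᴴ * S⁻¹ * H)) * C⁻¹ := by
    have : B⁻¹ * C * C⁻¹ = (1 + Q * (Hᴴ * S⁻¹ * H)) * C⁻¹ := by
      rw [h, ← Matrix.mul_assoc B⁻¹, nonsing_inv_mul _ hB, Matrix.one_mul, ← h]
    rwa [Matrix.mul_assoc, mul_nonsing_inv _ hB', Matrix.mul_one] at this
  have h2 : Q * C = w • (Q * (Hᴴ * S⁻¹ * H)) := by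
    have : C = (B - w • (Hᴴ * R⁻¹ * H)) + w • (Hᴴ * S⁻¹ * H) := by
      rw [hC]
      simp only [Matrix.mul_smul, Matrix.smul_mul, Matrix.mul_sub, Matrix.sub_mul, smul_sub]
      abel
    rw [this, Matrix.mul_add, hE', zero_add, Matrix.mul_smul]
  rw [h1, Matrix.add_mul, Matrix.one_mul, add_sub_cancel_left, ← Matrix.smul_mul, ← h2,
    Matrix.mul_assoc, mul_nonsing_inv _ hB', Matrix.mul_one]

theorem dual_step_complementary (hS : IsUnit S.det) (hR : IsUnit R.det)
    (e : R = S + H * Q * Hᴴ)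
    (hE' : Q * (B - w • (Hᴴ * R⁻¹ * H)) = 0) (hB : IsUnit B.det) :
    (w • (S⁻¹ - R⁻¹)) * (R - w • (H * B⁻¹ * Hᴴ)) = 0 := by
  rw [Matrix.mul_sub, sub_eq_zero] at hE'
  rw [inv_sub_inv_eq_mul hS hR e, Matrix.smul_mul, Matrix.mul_sub, Matrix.mul_assoc _ R⁻¹ R,
    nonsing_inv_mul _ hR, Matrix.mul_one]
  have : S⁻¹ * (H * Q * Hᴴ) * R⁻¹ * (w • (H * B⁻¹ * Hᴴ))
      = S⁻¹ * H * (Q * (w • (Hᴴ * R⁻¹ * H))) * B⁻¹ * Hᴴ := by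
    simp only [Matrix.mul_smul, Matrix.smul_mul, Matrix.mul_assoc]
  rw [this, ← hE']
  have : S⁻¹ * H * (Q * B) * B⁻¹ * Hᴴ = S⁻¹ * H * Q * (B * B⁻¹) * Hᴴ := by
    simp only [Matrix.mul_assoc]
  rw [this, mul_nonsing_inv _ hB]
  simp only [Matrix.mul_assoc, Matrix.one_mul, sub_self, smul_zero]

end DualStep

end Matrix

open Matrix

noncomputable section

/-! ### Encoding orders and summation by parts -/

section Sums

variable {K : ℕ} {M : Type*} [AddCommMonoid M]

/-- The users at the first `n` positions of the order `π`. -/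
def firstUsers (π : Equiv.Perm (Fin K)) (n : ℕ) : Finset (Fin K) :=
  Finset.univ.filter fun j => (π j : ℕ) < n

theorem mem_firstUsers {π : Equiv.Perm (Fin K)} {n : ℕ} {j : Fin K} :
    j ∈ firstUsers π n ↔ (π j : ℕ) < n := by simp [firstUsers]

theorem firstUsers_succ (π : Equiv.Perm (Fin K)) (k : Fin K) :
    firstUsers π (π k + 1) = insert k (firstUsers π (π k)) := by
  ext j
  simp only [mem_firstUsers, Finset.mem_insert]
  constructor
  · intro h
    rcases lt_or_eq_of_le (Nat.lt_succ_iff.mp h) with h | h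
    · exact Or.inr h
    · exact Or.inl (π.injective (Fin.ext h))
  · rintro (rfl | h) <;> omega

theorem not_mem_firstUsers_self (π : Equiv.Perm (Fin K)) (k : Fin K) :
    k ∉ firstUsers π (π k) := by simp [mem_firstUsers]

theorem sum_filter_le_eq (π : Equiv.Perm (Fin K)) (k : Fin K) (f : Fin K → M) :
    ∑ j with π k ≤ π j, f j = f k + ∑ j with π k < π j, f j := by
  have : (Finset.univ.filter fun j => π k ≤ π j)
      = insert k (Finset.univ.filter fun j => π k < π j) := by
    ext j
    simp only [Finset.mem_filter, Finset.mem_univ, true_and, Finset.mem_insert]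
    rw [le_iff_eq_or_lt, π.injective.eq_iff, eq_comm]
  rw [this, Finset.sum_insert (by simp)]

theorem sum_comp_perm_eq_sum_range (π : Equiv.Perm (Fin K)) (g : ℕ → M) :
    ∑ j, g (π j) = ∑ p ∈ Finset.range K, g p := by
  rw [Equiv.sum_comp π (fun i : Fin K => g i), Fin.sum_univ_eq_sum_range]

theorem sum_filter_perm_eq_sum_range (π : Equiv.Perm (Fin K)) (P : ℕ → Prop) [DecidablePred P]
    (g : ℕ → M) :
    ∑ j with P (π j), g (π j) = ∑ p ∈ Finset.range K with P p, g p := by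
  rw [Finset.sum_filter, Finset.sum_filter]
  exact sum_comp_perm_eq_sum_range π fun p => if P p then g p else 0

theorem sum_suffix_eq_sum_Ico (π : Equiv.Perm (Fin K)) (k : Fin K) (g : ℕ → M) :
    ∑ j with π k ≤ π j, g (π j) = ∑ p ∈ Finset.Ico (π k : ℕ) K, g p := by
  have h := sum_filter_perm_eq_sum_range π (fun p => (π k : ℕ) ≤ p) g
  have : (Finset.range K).filter (fun p => (π k : ℕ) ≤ p) = Finset.Ico (π k : ℕ) K := by
    ext p; simp [and_comm]
  rw [this] at h
  exact h

theorem sum_firstUsers_eq_sum_range (π : Equiv.Perm (Fin K)) {n : ℕ} (hn : n ≤ K) (g : ℕ → M) :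
    ∑ j ∈ firstUsers π n, g (π j) = ∑ p ∈ Finset.range n, g p := by
  rw [firstUsers, sum_filter_perm_eq_sum_range π (fun p => p < n) g]
  congr 1
  ext p; simp only [Finset.mem_filter, Finset.mem_range]; omega

/-- The weight of the user at position `p`, and zero beyond the last position. -/
def weightAt (w : Fin K → ℝ) (π : Equiv.Perm (Fin K)) (p : ℕ) : ℝ :=
  if h : p < K then w (π.symm ⟨p, h⟩) else 0

/-- The decrease of the weight from position `p` to the next one. -/
def weightDrop (w : Fin K → ℝ) (π : Equiv.Perm (Fin K)) (p : ℕ) : ℝ :=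
  weightAt w π p - weightAt w π (p + 1)

@[simp]
theorem weightAt_apply (w : Fin K → ℝ) (π : Equiv.Perm (Fin K)) (k : Fin K) :
    weightAt w π (π k) = w k := by simp [weightAt]

@[simp]
theorem weightAt_self (w : Fin K → ℝ) (π : Equiv.Perm (Fin K)) : weightAt w π K = 0 := by
  simp [weightAt]

/-- As `weightAt` vanishes past the end, the drop at the last position is the last weight itself;
hence the sign of the weights matters besides their ordering. -/
theorem weightDrop_nonneg {w : Fin K → ℝ} (hw : ∀ i, 0 ≤ w i) {π : Equiv.Perm (Fin K)}
    (hπ : ∀ i j, π i ≤ π j → w j ≤ w i) (p : ℕ) : 0 ≤ weightDrop w π p := by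
  rw [weightDrop, sub_nonneg, weightAt]
  split_ifs with h
  · rw [weightAt, dif_pos (by omega : p < K)]
    exact hπ _ _ (by simp [Fin.le_def])
  · rw [weightAt]; split_ifs
    · exact hw _
    · exact le_rfl

theorem sum_weightDrop (w : Fin K → ℝ) (π : Equiv.Perm (Fin K)) (k : Fin K) :
    ∑ p ∈ Finset.Ico (π k : ℕ) K, weightDrop w π p = w k := by
  have h := Finset.sum_Ico_sub (weightAt w π) (π k).isLt.le
  rw [weightAt_self, weightAt_apply, zero_sub] at h
  rw [← neg_inj, ← h, ← Finset.sum_neg_distrib]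
  exact Finset.sum_congr rfl fun p _ => by rw [weightDrop]; ring

/-- Summation by parts along an encoding order. -/
theorem sum_weight_mul_eq (w : Fin K → ℝ) (π : Equiv.Perm (Fin K)) (r : Fin K → ℝ) :
    ∑ k, w k * r k
      = ∑ p ∈ Finset.range K, weightDrop w π p * ∑ k ∈ firstUsers π (p + 1), r k := by
  have h1 : ∀ k, w k * r k
      = ∑ p ∈ Finset.range K, if (π k : ℕ) < p + 1 then weightDrop w π p * r k else 0 := by
    intro k
    rw [← sum_weightDrop w π k, Finset.sum_mul, ← Finset.sum_filter]
    congr 1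
    ext p; simp only [Finset.mem_filter, Finset.mem_range, Finset.mem_Ico]; omega
  rw [Finset.sum_congr rfl fun k _ => h1 k, Finset.sum_comm]
  refine Finset.sum_congr rfl fun p _ => ?_
  rw [firstUsers, Finset.mul_sum, ← Finset.sum_filter]

/-- Abel summation; the boundary term at `K` vanishes because the weight there is zero. With `c` the
inverse MAC covariances, the first sum becomes the signal plus interference of user `k` and the
second the MAC gradient. -/
theorem sum_suffix_weight_smul {E : Type*} [AddCommGroup E] [Module ℂ E] (w : Fin K → ℝ)
    (π : Equiv.Perm (Fin K)) (k : Fin K) (c : ℕ → E) :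
    ∑ j with π k ≤ π j, (w j : ℂ) • (c (π j) - c (π j + 1))
      + ∑ p ∈ Finset.Ico (π k : ℕ) K, (weightDrop w π p : ℂ) • c (p + 1)
      = (w k : ℂ) • c (π k) := by
  have h1 := sum_suffix_eq_sum_Ico π k
    (fun p => (weightAt w π p : ℂ) • (c p - c (p + 1)))
  simp only [weightAt_apply] at h1
  rw [h1, ← Finset.sum_add_distrib]
  have h := Finset.sum_Ico_sub (fun p => (weightAt w π p : ℂ) • c p) (π k).isLt.le
  simp only [weightAt_self, weightAt_apply, Complex.ofReal_zero, zero_smul, zero_sub] at h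
  rw [← neg_inj, ← h, ← Finset.sum_neg_distrib]
  refine Finset.sum_congr rfl fun p _ => ?_
  rw [weightDrop]
  push_cast
  module

end Sums

/-! ### The broadcast channel and its dual multiple access channel -/

section Channel

variable {K Nt Nr : ℕ}

/-- Covariance of the signal, interference and noise seen by user `k` in the broadcast channel. -/
def signalCov (H : Fin K → Matrix (Fin Nr) (Fin Nt) ℂ) (π : Equiv.Perm (Fin K))
    (Q : Fin K → Matrix (Fin Nt) (Fin Nt) ℂ) (k : Fin K) : Matrix (Fin Nr) (Fin Nr) ℂ :=
  1 + H k * (∑ j with π k ≤ π j, Q j) * (H k)ᴴ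

/-- Covariance of the interference and noise seen by user `k` in the broadcast channel. -/
def interferenceCov (H : Fin K → Matrix (Fin Nr) (Fin Nt) ℂ) (π : Equiv.Perm (Fin K))
    (Q : Fin K → Matrix (Fin Nt) (Fin Nt) ℂ) (k : Fin K) : Matrix (Fin Nr) (Fin Nr) ℂ :=
  1 + H k * (∑ j with π k < π j, Q j) * (H k)ᴴ

/-- Covariance received in the dual multiple access channel with noise covariance `A` when the
users in `s` transmit with covariances `X`. -/
def macCov (A : Matrix (Fin Nt) (Fin Nt) ℂ) (H : Fin K → Matrix (Fin Nr) (Fin Nt) ℂ)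
    (X : Fin K → Matrix (Fin Nr) (Fin Nr) ℂ) (s : Finset (Fin K)) : Matrix (Fin Nt) (Fin Nt) ℂ :=
  A + ∑ j ∈ s, (H j)ᴴ * X j * H j

/-- The covariances for the dual multiple access channel determined by broadcast covariances. -/
def dualCov (H : Fin K → Matrix (Fin Nr) (Fin Nt) ℂ) (w : Fin K → ℝ) (π : Equiv.Perm (Fin K))
    (Q : Fin K → Matrix (Fin Nt) (Fin Nt) ℂ) (k : Fin K) : Matrix (Fin Nr) (Fin Nr) ℂ :=
  (w k : ℂ) • ((interferenceCov H π Q k)⁻¹ - (signalCov H π Q k)⁻¹)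

/-- `A` minus the gradient of the weighted sum rate with respect to `Q k`. -/
def slack (H : Fin K → Matrix (Fin Nr) (Fin Nt) ℂ) (w : Fin K → ℝ) (π : Equiv.Perm (Fin K))
    (A : Matrix (Fin Nt) (Fin Nt) ℂ) (Q : Fin K → Matrix (Fin Nt) (Fin Nt) ℂ) (k : Fin K) :
    Matrix (Fin Nt) (Fin Nt) ℂ :=
  macCov A H (dualCov H w π Q) (firstUsers π (π k))
    - (w k : ℂ) • ((H k)ᴴ * (signalCov H π Q k)⁻¹ * H k)

/-- First-order optimality conditions for maximizing the weighted sum rate minus `tr (Q * A)`. -/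
structure IsRateStationary (H : Fin K → Matrix (Fin Nr) (Fin Nt) ℂ) (w : Fin K → ℝ)
    (π : Equiv.Perm (Fin K)) (A : Matrix (Fin Nt) (Fin Nt) ℂ)
    (Q : Fin K → Matrix (Fin Nt) (Fin Nt) ℂ) : Prop where
  posSemidef : ∀ k, (Q k).PosSemidef
  slack_posSemidef : ∀ k, (slack H w π A Q k).PosSemidef
  slack_mul : ∀ k, slack H w π A Q k * Q k = 0

variable {H : Fin K → Matrix (Fin Nr) (Fin Nt) ℂ} {w : Fin K → ℝ} {π : Equiv.Perm (Fin K)}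
  {A : Matrix (Fin Nt) (Fin Nt) ℂ} {Q : Fin K → Matrix (Fin Nt) (Fin Nt) ℂ}
  {X : Fin K → Matrix (Fin Nr) (Fin Nr) ℂ}

theorem signalCov_eq (H : Fin K → Matrix (Fin Nr) (Fin Nt) ℂ) (π : Equiv.Perm (Fin K))
    (Q : Fin K → Matrix (Fin Nt) (Fin Nt) ℂ) (k : Fin K) :
    signalCov H π Q k = interferenceCov H π Q k + H k * Q k * (H k)ᴴ := by
  rw [signalCov, interferenceCov, sum_filter_le_eq, Matrix.mul_add, Matrix.add_mul]
  abel

theorem signalCov_posDef (hQ : ∀ k, (Q k).PosSemidef) (k : Fin K) :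
    (signalCov H π Q k).PosDef :=
  PosDef.one.add_posSemidef
    ((posSemidef_sum _ fun j _ => hQ j).mul_mul_conjTranspose_same _)

theorem interferenceCov_posDef (hQ : ∀ k, (Q k).PosSemidef) (k : Fin K) :
    (interferenceCov H π Q k).PosDef :=
  PosDef.one.add_posSemidef
    ((posSemidef_sum _ fun j _ => hQ j).mul_mul_conjTranspose_same _)

theorem signalCov_sub_posSemidef (hQ : ∀ k, (Q k).PosSemidef) (k : Fin K) :
    (signalCov H π Q k - interferenceCov H π Q k).PosSemidef := by
  rw [signalCov_eq, add_sub_cancel_left]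
  exact (hQ k).mul_mul_conjTranspose_same _

theorem dpcRate_eq (hQ : ∀ k, (Q k).PosSemidef) (k : Fin K) :
    dpcRate H π Q k = logDet (signalCov H π Q k) - logDet (interferenceCov H π Q k) :=
  Real.log_div (signalCov_posDef hQ k).det_re_pos.ne' (interferenceCov_posDef hQ k).det_re_pos.ne'

theorem posSemidef_ofReal_smul {n : Type*} {M : Matrix n n ℂ} (hM : M.PosSemidef) {c : ℝ}
    (hc : 0 ≤ c) : ((c : ℂ) • M).PosSemidef :=
  hM.smul (Complex.zero_le_real.mpr hc)

theorem dualCov_posSemidef (hw : ∀ i, 0 ≤ w i) (hQ : ∀ k, (Q k).PosSemidef) (k : Fin K) :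
    (dualCov H w π Q k).PosSemidef :=
  posSemidef_ofReal_smul ((interferenceCov_posDef hQ k).inv_sub_inv_posSemidef
    (signalCov_posDef hQ k) (signalCov_sub_posSemidef hQ k)) (hw k)

theorem macCov_posDef (hA : A.PosDef) (hX : ∀ k, (X k).PosSemidef) (s : Finset (Fin K)) :
    (macCov A H X s).PosDef :=
  hA.add_posSemidef (posSemidef_sum _ fun j _ => (hX j).conjTranspose_mul_mul_same _)

theorem macCov_insert {k : Fin K} {s : Finset (Fin K)} (hk : k ∉ s) :
    macCov A H X (insert k s) = macCov A H X s + (H k)ᴴ * X k * H k := by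
  rw [macCov, macCov, Finset.sum_insert hk]; abel

theorem macCov_sub_posSemidef (hX : ∀ k, (X k).PosSemidef) {s t : Finset (Fin K)} (h : s ⊆ t) :
    (macCov A H X t - macCov A H X s).PosSemidef := by
  have : macCov A H X t - macCov A H X s = ∑ j ∈ t \ s, (H j)ᴴ * X j * H j := by
    rw [macCov, macCov, ← Finset.sum_sdiff h]; abel
  rw [this]
  exact posSemidef_sum _ fun j _ => (hX j).conjTranspose_mul_mul_same _

/-- The rate of user `k` in the multiple access channel, decoded without the interference of the
users encoded later. -/
def macRate (A : Matrix (Fin Nt) (Fin Nt) ℂ) (H : Fin K → Matrix (Fin Nr) (Fin Nt) ℂ)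
    (X : Fin K → Matrix (Fin Nr) (Fin Nr) ℂ) (π : Equiv.Perm (Fin K)) (k : Fin K) : ℝ :=
  logDet (macCov A H X (firstUsers π (π k + 1))) - logDet (macCov A H X (firstUsers π (π k)))

/-- Submodularity: the user of `s` at the last position sees at least the interference of the rest
of `s`, and a log-determinant increment shrinks as its base grows. Equality holds for initial
segments of the order, which is why the order of nonincreasing weights wins. -/
theorem sum_macRate_le (hA : A.PosDef) (hX : ∀ k, (X k).PosSemidef) (s : Finset (Fin K)) :
    ∑ k ∈ s, macRate A H X π k ≤ logDet (macCov A H X s) - logDet A := by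
  induction s using Finset.induction_on_max_value (fun k => π k) with
  | empty => simp [macCov]
  | insert a s ha hmax ih =>
    rw [Finset.sum_insert ha]
    have hs : s ⊆ firstUsers π (π a) := fun x hx => by
      rw [mem_firstUsers]
      exact lt_of_le_of_ne (hmax x hx) fun h => ha (π.injective (Fin.ext h) ▸ hx)
    have h := (macCov_posDef (H := H) hA hX s).logDet_add_sub_antitone
      (macCov_posDef hA hX _) (macCov_sub_posSemidef hX hs)
      ((hX a).conjTranspose_mul_mul_same (H a))
    rw [← macCov_insert ha, ← macCov_insert (not_mem_firstUsers_self π a),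
      ← firstUsers_succ] at h
    rw [macRate]; linarith

theorem sum_firstUsers_macRate {n : ℕ} (hn : n ≤ K) :
    ∑ k ∈ firstUsers π n, macRate A H X π k
      = logDet (macCov A H X (firstUsers π n)) - logDet A := by
  have h := sum_firstUsers_eq_sum_range π hn fun p =>
    logDet (macCov A H X (firstUsers π (p + 1))) - logDet (macCov A H X (firstUsers π p))
  rw [Finset.sum_range_sub fun p => logDet (macCov A H X (firstUsers π p))] at h
  simpa [macRate, macCov, firstUsers] using h

/-- Decoding in an order in which the weights decrease is optimal in the multiple access
channel. -/
theorem sum_weight_macRate_le (hw : ∀ i, 0 ≤ w i) (hπ : ∀ i j, π i ≤ π j → w j ≤ w i)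
    (hA : A.PosDef) (hX : ∀ k, (X k).PosSemidef) (π' : Equiv.Perm (Fin K)) :
    ∑ k, w k * macRate A H X π' k ≤ ∑ k, w k * macRate A H X π k := by
  rw [sum_weight_mul_eq w π, sum_weight_mul_eq w π]
  refine Finset.sum_le_sum fun p hp => mul_le_mul_of_nonneg_left ?_ (weightDrop_nonneg hw hπ p)
  rw [sum_firstUsers_macRate (by simpa [Nat.succ_le_iff] using hp)]
  exact sum_macRate_le hA hX _

theorem re_trace_sum {n ι : Type*} [Fintype n] (s : Finset ι) (f : ι → Matrix n n ℂ) :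
    (∑ i ∈ s, f i).trace.re = ∑ i ∈ s, (f i).trace.re := by
  rw [trace_sum, Complex.re_sum]

theorem re_trace_smul {n : Type*} [Fintype n] (c : ℝ) (M : Matrix n n ℂ) :
    ((c : ℂ) • M).trace.re = c * M.trace.re := by
  rw [trace_smul, smul_eq_mul, Complex.re_ofReal_mul]

/-- The sensitivity matrix of the weighted sum rate of the multiple access channel with respect to
the covariance of user `k`. -/
def macGradient (A : Matrix (Fin Nt) (Fin Nt) ℂ) (H : Fin K → Matrix (Fin Nr) (Fin Nt) ℂ)
    (w : Fin K → ℝ) (π : Equiv.Perm (Fin K)) (X : Fin K → Matrix (Fin Nr) (Fin Nr) ℂ)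
    (k : Fin K) : Matrix (Fin Nr) (Fin Nr) ℂ :=
  H k * (∑ p ∈ Finset.Ico (π k : ℕ) K,
    (weightDrop w π p : ℂ) • (macCov A H X (firstUsers π (p + 1)))⁻¹) * (H k)ᴴ

/-- The weighted sum rate of the multiple access channel lies below its tangents. -/
theorem sum_weight_macRate_le_add (hw : ∀ i, 0 ≤ w i) (hπ : ∀ i j, π i ≤ π j → w j ≤ w i)
    (hA : A.PosDef) (hX : ∀ k, (X k).PosSemidef) {Y : Fin K → Matrix (Fin Nr) (Fin Nr) ℂ}
    (hY : ∀ k, (Y k).PosSemidef) :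
    ∑ k, w k * macRate A H Y π k ≤ ∑ k, w k * macRate A H X π k
      + ∑ k, (macGradient A H w π X k * (Y k - X k)).trace.re := by
  rw [sum_weight_mul_eq w π, sum_weight_mul_eq w π]
  have h1 : ∑ k, (macGradient A H w π X k * (Y k - X k)).trace.re
      = ∑ p ∈ Finset.range K, weightDrop w π p *
          ((macCov A H X (firstUsers π (p + 1)))⁻¹ *
            (macCov A H Y (firstUsers π (p + 1)) - macCov A H X (firstUsers π (p + 1)))).trace.re := by
    have e1 : ∀ k, (macGradient A H w π X k * (Y k - X k)).trace.re
        = ∑ p ∈ Finset.range K, if (π k : ℕ) < p + 1 then weightDrop w π p *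
          ((macCov A H X (firstUsers π (p + 1)))⁻¹ * ((H k)ᴴ * (Y k - X k) * H k)).trace.re
          else 0 := by
      intro k
      rw [← Finset.sum_filter]
      have : (Finset.range K).filter (fun p => (π k : ℕ) < p + 1) = Finset.Ico (π k : ℕ) K := by
        ext p; simp only [Finset.mem_filter, Finset.mem_range, Finset.mem_Ico]; omega
      rw [this, macGradient, Matrix.mul_assoc, Matrix.mul_assoc, trace_mul_comm, Matrix.mul_assoc,
        Matrix.sum_mul, re_trace_sum]
      refine Finset.sum_congr rfl fun p _ => ?_
      rw [Matrix.smul_mul, re_trace_smul, Matrix.mul_assoc]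
    rw [Finset.sum_congr rfl fun k _ => e1 k, Finset.sum_comm]
    refine Finset.sum_congr rfl fun p _ => ?_
    rw [← Finset.sum_filter, ← firstUsers, ← Finset.mul_sum, ← re_trace_sum, ← Matrix.mul_sum]
    congr 5
    rw [macCov, macCov, add_sub_add_left_eq_sub, ← Finset.sum_sub_distrib]
    exact Finset.sum_congr rfl fun j _ => by rw [Matrix.mul_sub, Matrix.sub_mul]
  rw [h1, ← Finset.sum_add_distrib]
  refine Finset.sum_le_sum fun p hp => ?_
  rw [← mul_add]
  refine mul_le_mul_of_nonneg_left ?_ (weightDrop_nonneg hw hπ p)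
  have hp' : p + 1 ≤ K := by simpa [Nat.succ_le_iff] using hp
  rw [sum_firstUsers_macRate hp', sum_firstUsers_macRate hp']
  have := (macCov_posDef (H := H) hA hY (firstUsers π (p + 1))).logDet_le
    (macCov_posDef (H := H) hA hX (firstUsers π (p + 1)))
  linarith

end Channel

/-! ### Stationary broadcast covariances and optimality in the dual channel -/

section Duality

variable {K Nt Nr : ℕ} {H : Fin K → Matrix (Fin Nr) (Fin Nt) ℂ} {w : Fin K → ℝ}
  {π : Equiv.Perm (Fin K)} {A : Matrix (Fin Nt) (Fin Nt) ℂ}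
  {Q : Fin K → Matrix (Fin Nt) (Fin Nt) ℂ}

namespace IsRateStationary

theorem mul_slack (hs : IsRateStationary H w π A Q) (k : Fin K) :
    Q k * slack H w π A Q k = 0 := by
  have h := congrArg conjTranspose (hs.slack_mul k)
  rwa [conjTranspose_mul, (hs.posSemidef k).1.eq, (hs.slack_posSemidef k).1.eq,
    conjTranspose_zero] at h

theorem macCov_succ (H : Fin K → Matrix (Fin Nr) (Fin Nt) ℂ) (w : Fin K → ℝ)
    (π : Equiv.Perm (Fin K)) (A : Matrix (Fin Nt) (Fin Nt) ℂ)
    (Q : Fin K → Matrix (Fin Nt) (Fin Nt) ℂ) (k : Fin K) :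
    macCov A H (dualCov H w π Q) (firstUsers π (π k + 1))
      = macCov A H (dualCov H w π Q) (firstUsers π (π k)) + (H k)ᴴ *
        ((w k : ℂ) • ((interferenceCov H π Q k)⁻¹ - (signalCov H π Q k)⁻¹)) * H k := by
  rw [firstUsers_succ, macCov_insert (not_mem_firstUsers_self π k)]
  rfl

theorem macRate_eq (hs : IsRateStationary H w π A Q) (hw : ∀ i, 0 ≤ w i) (hA : A.PosDef)
    (k : Fin K) : macRate A H (dualCov H w π Q) π k = dpcRate H π Q k := by
  have hX := dualCov_posSemidef (H := H) (π := π) hw hs.posSemidef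
  have h1 := macCov_posDef (H := H) hA hX (firstUsers π (π k + 1))
  have h0 := macCov_posDef (H := H) hA hX (firstUsers π (π k))
  have hS := interferenceCov_posDef (H := H) (π := π) hs.posSemidef k
  have hR := signalCov_posDef (H := H) (π := π) hs.posSemidef k
  have h := dual_step_det hS.isUnit_det hR.isUnit_det (signalCov_eq H π Q k) (hs.slack_mul k)
  rw [← macCov_succ, h1.det_eq_re, h0.det_eq_re, hS.det_eq_re, hR.det_eq_re] at h
  norm_cast at h
  have h2 := congrArg Real.log h
  rw [Real.log_mul h1.det_re_pos.ne' hS.det_re_pos.ne',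
    Real.log_mul h0.det_re_pos.ne' hR.det_re_pos.ne'] at h2
  rw [dpcRate_eq hs.posSemidef, macRate]
  simp only [logDet]
  linarith

theorem weightedSumRate_eq (hs : IsRateStationary H w π A Q) (hw : ∀ i, 0 ≤ w i)
    (hA : A.PosDef) :
    weightedSumRate H w π Q = ∑ k, w k * macRate A H (dualCov H w π Q) π k :=
  Finset.sum_congr rfl fun k _ => by rw [hs.macRate_eq hw hA]

/-- The dual covariances use the same power as the broadcast covariances. -/
theorem sum_trace_dualCov (hs : IsRateStationary H w π A Q) :
    ∑ k, (dualCov H w π Q k).trace = ((∑ k, Q k) * A).trace := by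
  set X := dualCov H w π Q with hX
  -- User by user, `Q k` against the MAC interference and `X k` against the broadcast interference
  -- have the same trace. After summation the cross terms on the two sides agree by exchanging the
  -- users, leaving only the two powers.
  have h1 : ∀ k, (Q k * macCov A H X (firstUsers π (π k))).trace
      = (w k : ℂ) * ((signalCov H π Q k)⁻¹ * (H k * Q k * (H k)ᴴ)).trace := by
    intro k
    have h := hs.mul_slack k
    rw [slack, Matrix.mul_sub, sub_eq_zero] at h
    rw [h, Matrix.mul_smul, trace_smul, smul_eq_mul]
    congr 1
    rw [trace_mul_comm, Matrix.mul_assoc, Matrix.mul_assoc, trace_mul_comm]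
    simp only [Matrix.mul_assoc]
  have h2 : ∀ k, (X k * interferenceCov H π Q k).trace
      = (w k : ℂ) * ((signalCov H π Q k)⁻¹ * (H k * Q k * (H k)ᴴ)).trace := by
    intro k
    have hS := (interferenceCov_posDef (H := H) (π := π) hs.posSemidef k).isUnit_det
    have hR := (signalCov_posDef (H := H) (π := π) hs.posSemidef k).isUnit_det
    rw [hX, dualCov, inv_sub_inv_eq_mul' hS hR (signalCov_eq H π Q k), Matrix.smul_mul,
      Matrix.mul_assoc _ _ (interferenceCov H π Q k), nonsing_inv_mul _ hS, Matrix.mul_one,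
      trace_smul, smul_eq_mul]
  have h3 : ∀ k, (X k * interferenceCov H π Q k).trace
      = (X k).trace + ∑ j with π k < π j, (Q j * ((H k)ᴴ * X k * H k)).trace := by
    intro k
    rw [interferenceCov, Matrix.mul_add, Matrix.mul_one, trace_add, ← trace_sum,
      ← Matrix.sum_mul]
    congr 1
    rw [← Matrix.mul_assoc, trace_mul_comm, ← Matrix.mul_assoc, ← Matrix.mul_assoc,
      ← Matrix.mul_assoc, trace_mul_comm]
    simp only [Matrix.mul_assoc]
  have h4 : ∀ k, (Q k * macCov A H X (firstUsers π (π k))).trace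
      = (Q k * A).trace + ∑ j with π j < π k, (Q k * ((H j)ᴴ * X j * H j)).trace := by
    intro k
    rw [macCov, Matrix.mul_add, trace_add, Matrix.mul_sum, trace_sum]
    rfl
  have h5 : ∑ k, (Q k * macCov A H X (firstUsers π (π k))).trace
      = ∑ k, (X k * interferenceCov H π Q k).trace :=
    Finset.sum_congr rfl fun k _ => (h1 k).trans (h2 k).symm
  rw [Finset.sum_congr rfl fun k _ => h4 k, Finset.sum_congr rfl fun k _ => h3 k,
    Finset.sum_add_distrib, Finset.sum_add_distrib] at h5
  have h6 : ∑ k, ∑ j with π k < π j, (Q j * ((H k)ᴴ * X k * H k)).trace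
      = ∑ k, ∑ j with π j < π k, (Q k * ((H j)ᴴ * X j * H j)).trace := by
    simp only [Finset.sum_filter]
    exact Finset.sum_comm
  rw [h6] at h5
  rw [Matrix.sum_mul, trace_sum]
  exact (add_right_cancel h5).symm

/-- Each `Q j` is a weighted difference of consecutive inverse MAC covariances, so the suffix sum in
`signalCov` telescopes against the gradient. -/
theorem one_sub_macGradient (hs : IsRateStationary H w π A Q) (hw : ∀ i, 0 ≤ w i)
    (hA : A.PosDef) (k : Fin K) :
    1 - macGradient A H w π (dualCov H w π Q) k = signalCov H π Q k - (w k : ℂ) •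
      (H k * (macCov A H (dualCov H w π Q) (firstUsers π (π k)))⁻¹ * (H k)ᴴ) := by
  have hX := dualCov_posSemidef (H := H) (π := π) hw hs.posSemidef
  have hQ : ∀ j, (w j : ℂ) • ((macCov A H (dualCov H w π Q) (firstUsers π (π j)))⁻¹
      - (macCov A H (dualCov H w π Q) (firstUsers π (π j + 1)))⁻¹) = Q j := by
    intro j
    have h1 := macCov_posDef (H := H) hA hX (firstUsers π (π j + 1))
    have h0 := macCov_posDef (H := H) hA hX (firstUsers π (π j))
    rw [macCov_succ] at h1 ⊢
    exact dual_step_inv_sub_inv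
      (interferenceCov_posDef (H := H) (π := π) hs.posSemidef j).isUnit_det
      (signalCov_posDef (H := H) (π := π) hs.posSemidef j).isUnit_det (signalCov_eq H π Q j)
      (hs.slack_mul j) (hs.mul_slack j) h0.isUnit_det h1.isUnit_det
  have h := sum_suffix_weight_smul w π k
    fun n => (macCov A H (dualCov H w π Q) (firstUsers π n))⁻¹
  simp only [hQ] at h
  have h' := congrArg (fun M => H k * M * (H k)ᴴ) h
  simp only [Matrix.mul_add, Matrix.add_mul, Matrix.mul_smul, Matrix.smul_mul] at h'
  rw [← h', signalCov, macGradient]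
  simp only [Matrix.mul_assoc]
  abel

theorem one_sub_macGradient_posSemidef (hs : IsRateStationary H w π A Q) (hw : ∀ i, 0 ≤ w i)
    (hA : A.PosDef) (k : Fin K) :
    (1 - macGradient A H w π (dualCov H w π Q) k).PosSemidef := by
  rw [hs.one_sub_macGradient hw hA]
  have hX := dualCov_posSemidef (H := H) (π := π) hw hs.posSemidef
  have h0 := macCov_posDef (H := H) hA hX (firstUsers π (π k))
  have hR := signalCov_posDef (H := H) (π := π) hs.posSemidef k
  -- The weight is absorbed into the channel as `√(w k) • H k`, to fit the Schur complement
  -- exchange.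
  have hc : ((√(w k) : ℝ) : ℂ) * ((√(w k) : ℝ) : ℂ) = (w k : ℂ) := by
    rw [← Complex.ofReal_mul, Real.mul_self_sqrt (hw k)]
  have h := h0.sub_posSemidef_swap hR (H := ((√(w k) : ℝ) : ℂ) • H k) (by
    convert hs.slack_posSemidef k using 1
    rw [slack, conjTranspose_smul, Complex.star_def, Complex.conj_ofReal]
    simp only [Matrix.smul_mul, Matrix.mul_smul, smul_smul, hc])
  convert h using 1
  rw [conjTranspose_smul, Complex.star_def, Complex.conj_ofReal]
  simp only [Matrix.smul_mul, Matrix.mul_smul, smul_smul, hc]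

theorem dualCov_mul_one_sub_macGradient (hs : IsRateStationary H w π A Q)
    (hw : ∀ i, 0 ≤ w i) (hA : A.PosDef) (k : Fin K) :
    dualCov H w π Q k * (1 - macGradient A H w π (dualCov H w π Q) k) = 0 := by
  rw [hs.one_sub_macGradient hw hA]
  have hX := dualCov_posSemidef (H := H) (π := π) hw hs.posSemidef
  exact dual_step_complementary
    (interferenceCov_posDef (H := H) (π := π) hs.posSemidef k).isUnit_det
    (signalCov_posDef (H := H) (π := π) hs.posSemidef k).isUnit_det (signalCov_eq H π Q k)
    (hs.mul_slack k) (macCov_posDef (H := H) hA hX (firstUsers π (π k))).isUnit_det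

/-- Stationary broadcast covariances yield optimal covariances for the Lagrangian of the dual
multiple access channel. -/
theorem sum_weight_macRate_sub_le (hs : IsRateStationary H w π A Q) (hw : ∀ i, 0 ≤ w i)
    (hπ : ∀ i j, π i ≤ π j → w j ≤ w i) (hA : A.PosDef)
    {Y : Fin K → Matrix (Fin Nr) (Fin Nr) ℂ} (hY : ∀ k, (Y k).PosSemidef) :
    ∑ k, w k * macRate A H Y π k - ∑ k, (Y k).trace.re
      ≤ weightedSumRate H w π Q - ((∑ k, Q k) * A).trace.re := by
  have hX := dualCov_posSemidef (H := H) (π := π) hw hs.posSemidef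
  have h := sum_weight_macRate_le_add (H := H) hw hπ hA hX hY
  rw [← hs.weightedSumRate_eq hw hA] at h
  have h1 : ∑ k, (macGradient A H w π (dualCov H w π Q) k * (Y k - dualCov H w π Q k)).trace.re
      ≤ ∑ k, ((Y k).trace.re - (dualCov H w π Q k).trace.re) := by
    refine Finset.sum_le_sum fun k _ => ?_
    have e1 := (hs.one_sub_macGradient_posSemidef hw hA k).re_trace_mul_nonneg (hY k)
    have e2 := congrArg (fun M => M.trace.re) (hs.dualCov_mul_one_sub_macGradient hw hA k)
    simp only [Matrix.sub_mul, Matrix.mul_sub, Matrix.mul_one, Matrix.one_mul, trace_sub,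
      Complex.sub_re, trace_zero, Complex.zero_re] at e1 e2 ⊢
    rw [trace_mul_comm] at e2
    linarith
  have h2 := congrArg Complex.re hs.sum_trace_dualCov
  rw [Complex.re_sum] at h2
  rw [Finset.sum_sub_distrib, h2] at h1
  linarith

end IsRateStationary

end Duality

/-! ### First-order optimality conditions -/

section FirstOrder

theorem isClosed_setOf_posSemidef {n : Type*} [Fintype n] :
    IsClosed {M : Matrix n n ℂ | M.PosSemidef} := by
  have : {M : Matrix n n ℂ | M.PosSemidef}
      = {M | Mᴴ = M} ∩ ⋂ x : n → ℂ, {M | 0 ≤ (star x ⬝ᵥ (M *ᵥ x)).re} := by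
    ext M
    simp only [Set.mem_ofPred_eq, Set.mem_inter_iff, Set.mem_iInter]
    exact ⟨fun h => ⟨h.1, fun x => h.re_dotProduct_nonneg x⟩,
      fun h => posSemidef_of_re_dotProduct_nonneg h.1 h.2⟩
  rw [this]
  refine (isClosed_eq (by fun_prop) (by fun_prop)).inter (isClosed_iInter fun x => ?_)
  exact isClosed_le continuous_const (Complex.continuous_re.comp
    (continuous_const.dotProduct (continuous_id.matrix_mulVec continuous_const)))

/-- The sum of all squared entries is `tr (M * M)`, which is at most `(tr M)²` because `M` lies
below its trace times the identity. -/
theorem Matrix.PosSemidef.norm_apply_le_re_trace {n : Type*} [Fintype n] [DecidableEq n]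
    {M : Matrix n n ℂ} (hM : M.PosSemidef) (i j : n) : ‖M i j‖ ≤ M.trace.re := by
  have h1 := hM.re_trace_mul_nonneg hM.smul_trace_sub_posSemidef
  rw [Matrix.mul_sub, trace_sub, Complex.sub_re, Matrix.mul_smul, re_trace_smul,
    Matrix.mul_one] at h1
  have h2 : (M * M).trace.re = ∑ i, ∑ j, ‖M i j‖ ^ 2 := by
    conv_lhs => enter [1, 1, 2]; rw [← hM.1.eq]
    simp only [trace, diag_apply, Matrix.mul_apply, conjTranspose_apply, Complex.re_sum]
    refine Finset.sum_congr rfl fun i _ => Finset.sum_congr rfl fun j _ => ?_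
    rw [Complex.star_def, Complex.mul_conj, Complex.ofReal_re, Complex.normSq_eq_norm_sq]
  have h3 : ‖M i j‖ ^ 2 ≤ ∑ i, ∑ j, ‖M i j‖ ^ 2 :=
    (Finset.single_le_sum (f := fun j => ‖M i j‖ ^ 2) (fun _ _ => by positivity)
      (Finset.mem_univ j)).trans
    (Finset.single_le_sum (f := fun i => ∑ j, ‖M i j‖ ^ 2) (fun _ _ => by positivity)
      (Finset.mem_univ i))
  exact abs_le_of_sq_le_sq' (by nlinarith) hM.re_trace_nonneg |>.2

variable {K Nt Nr : ℕ} {H : Fin K → Matrix (Fin Nr) (Fin Nt) ℂ} {w : Fin K → ℝ}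
  {π : Equiv.Perm (Fin K)} {A : Matrix (Fin Nt) (Fin Nt) ℂ}
  {Q D : Fin K → Matrix (Fin Nt) (Fin Nt) ℂ}

/-- The gradient of the weighted sum rate with respect to the covariance of user `k`. -/
def rateGradient (H : Fin K → Matrix (Fin Nr) (Fin Nt) ℂ) (w : Fin K → ℝ)
    (π : Equiv.Perm (Fin K)) (Q : Fin K → Matrix (Fin Nt) (Fin Nt) ℂ) (k : Fin K) :
    Matrix (Fin Nt) (Fin Nt) ℂ :=
  (w k : ℂ) • ((H k)ᴴ * (signalCov H π Q k)⁻¹ * H k)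
    - ∑ j ∈ firstUsers π (π k), (H j)ᴴ * dualCov H w π Q j * H j

theorem slack_eq_sub_rateGradient (k : Fin K) :
    slack H w π A Q k = A - rateGradient H w π Q k := by
  rw [slack, rateGradient, macCov]; abel

theorem rateGradient_isHermitian (hw : ∀ i, 0 ≤ w i) (hQ : ∀ k, (Q k).PosSemidef) (k : Fin K) :
    (rateGradient H w π Q k).IsHermitian :=
  (posSemidef_ofReal_smul ((signalCov_posDef hQ k).inv.posSemidef.conjTranspose_mul_mul_same _)
    (hw k)).1.sub
    (posSemidef_sum _ fun j _ => (dualCov_posSemidef hw hQ j).conjTranspose_mul_mul_same _).1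

/-- Exchanging the order of summation regroups the effect of each covariance on all rates into the
variation of each rate. -/
theorem sum_rateGradient_mul (H : Fin K → Matrix (Fin Nr) (Fin Nt) ℂ) (w : Fin K → ℝ)
    (π : Equiv.Perm (Fin K)) (Q D : Fin K → Matrix (Fin Nt) (Fin Nt) ℂ) :
    ∑ k, (rateGradient H w π Q k * D k).trace.re
      = ∑ k, w k * (((signalCov H π Q k)⁻¹ * (H k * (∑ j with π k ≤ π j, D j) * (H k)ᴴ)).trace.re
        - ((interferenceCov H π Q k)⁻¹ *
          (H k * (∑ j with π k < π j, D j) * (H k)ᴴ)).trace.re) := by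
  have hcyc : ∀ (k : Fin K) (Z : Matrix (Fin Nr) (Fin Nr) ℂ) (E : Matrix (Fin Nt) (Fin Nt) ℂ),
      ((H k)ᴴ * Z * H k * E).trace = (Z * (H k * E * (H k)ᴴ)).trace := by
    intro k Z E
    rw [Matrix.mul_assoc, Matrix.mul_assoc, trace_mul_comm]
    simp only [Matrix.mul_assoc]
  have h1 : ∀ k, (rateGradient H w π Q k * D k).trace.re
      = w k * ((signalCov H π Q k)⁻¹ * (H k * D k * (H k)ᴴ)).trace.re
        - ∑ j with π j < π k, (dualCov H w π Q j * (H j * D k * (H j)ᴴ)).trace.re := by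
    intro k
    rw [rateGradient, Matrix.sub_mul, trace_sub, Complex.sub_re, Matrix.smul_mul, re_trace_smul,
      hcyc, Matrix.sum_mul, re_trace_sum]
    congr 1
    exact Finset.sum_congr rfl fun j _ => by rw [hcyc]
  have h2 : ∀ k, w k * (((signalCov H π Q k)⁻¹ *
        (H k * (∑ j with π k ≤ π j, D j) * (H k)ᴴ)).trace.re
        - ((interferenceCov H π Q k)⁻¹ * (H k * (∑ j with π k < π j, D j) * (H k)ᴴ)).trace.re)
      = w k * ((signalCov H π Q k)⁻¹ * (H k * D k * (H k)ᴴ)).trace.re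
        - ∑ j with π k < π j, (dualCov H w π Q k * (H k * D j * (H k)ᴴ)).trace.re := by
    intro k
    rw [← re_trace_sum, ← Matrix.mul_sum, ← Matrix.sum_mul, ← Matrix.mul_sum, dualCov,
      Matrix.smul_mul, re_trace_smul, sum_filter_le_eq]
    simp only [Matrix.mul_add, Matrix.add_mul, Matrix.sub_mul, trace_add, trace_sub,
      Complex.add_re, Complex.sub_re]
    ring
  rw [Finset.sum_congr rfl fun k _ => h1 k, Finset.sum_congr rfl fun k _ => h2 k,
    Finset.sum_sub_distrib, Finset.sum_sub_distrib]
  congr 1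
  simp only [Finset.sum_filter]
  exact Finset.sum_comm

theorem signalCov_add_smul (t : ℂ) (k : Fin K) :
    signalCov H π (Q + t • D) k
      = signalCov H π Q k + t • (H k * (∑ j with π k ≤ π j, D j) * (H k)ᴴ) := by
  simp only [signalCov, Pi.add_apply, Pi.smul_apply, Finset.sum_add_distrib, ← Finset.smul_sum,
    Matrix.mul_add, Matrix.add_mul, Matrix.mul_smul, Matrix.smul_mul]
  abel

theorem interferenceCov_add_smul (t : ℂ) (k : Fin K) :
    interferenceCov H π (Q + t • D) k
      = interferenceCov H π Q k + t • (H k * (∑ j with π k < π j, D j) * (H k)ᴴ) := by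
  simp only [interferenceCov, Pi.add_apply, Pi.smul_apply, Finset.sum_add_distrib,
    ← Finset.smul_sum, Matrix.mul_add, Matrix.add_mul, Matrix.mul_smul, Matrix.smul_mul]
  abel

/-- A one-sided growth bound along a feasible direction bounds the directional derivative of the
weighted sum rate. -/
theorem sum_rateGradient_le_of_forall (hw : ∀ i, 0 ≤ w i) (hQ : ∀ k, (Q k).PosSemidef)
    (hD : ∀ t : ℝ, 0 < t → t ≤ 1 → ∀ k, ((Q + (t : ℂ) • D) k).PosSemidef) {c : ℝ}
    (h : ∀ t : ℝ, 0 < t → t ≤ 1 →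
      weightedSumRate H w π (Q + (t : ℂ) • D) ≤ weightedSumRate H w π Q + t * c) :
    ∑ k, (rateGradient H w π Q k * D k).trace.re ≤ c := by
  rw [sum_rateGradient_mul]
  set U : Fin K → Matrix (Fin Nr) (Fin Nr) ℂ :=
    fun k => H k * (∑ j with π k ≤ π j, D j) * (H k)ᴴ with hU
  set V : Fin K → Matrix (Fin Nr) (Fin Nr) ℂ :=
    fun k => H k * (∑ j with π k < π j, D j) * (H k)ᴴ with hV
  -- The signal term uses the tangent at the moved point and the interference term the tangent at
  -- `Q`. By concavity both err downwards, so `t * φ t` bounds the increment from below, and `t → 0`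
  -- gives the derivative.
  set φ : ℝ → ℝ := fun t => ∑ k, w k *
    (((signalCov H π Q k + (t : ℂ) • U k)⁻¹ * U k).trace.re
      - ((interferenceCov H π Q k)⁻¹ * V k).trace.re) with hφ
  have hcont : ContinuousAt φ 0 := by
    refine tendsto_finsetSum _ fun k _ => ?_
    have h1 : ContinuousAt (fun t : ℝ => (signalCov H π Q k + (t : ℂ) • U k)⁻¹) 0 := by
      have h2 : ContinuousAt (fun t : ℝ => signalCov H π Q k + (t : ℂ) • U k) 0 := by fun_prop
      refine ContinuousAt.comp (g := fun N : Matrix (Fin Nr) (Fin Nr) ℂ => N⁻¹) ?_ h2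
      refine continuousAt_matrix_inv _ ?_
      rw [Ring.inverse_eq_inv']
      refine continuousAt_inv₀ ?_
      simpa using (signalCov_posDef (H := H) (π := π) hQ k).isUnit_det.ne_zero
    have h3 : Continuous fun M : Matrix (Fin Nr) (Fin Nr) ℂ => (M * U k).trace.re := by fun_prop
    exact ((h3.continuousAt.tendsto.comp h1).sub_const _).const_mul _
  have hle : ∀ t : ℝ, 0 < t → t ≤ 1 → φ t ≤ c := by
    intro t ht ht1
    have hQt := hD t ht ht1
    have h1 : t * φ t ≤ weightedSumRate H w π (Q + (t : ℂ) • D) - weightedSumRate H w π Q := by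
      rw [hφ, weightedSumRate, weightedSumRate, Finset.mul_sum, ← Finset.sum_sub_distrib]
      refine Finset.sum_le_sum fun k _ => ?_
      rw [dpcRate_eq hQt, dpcRate_eq hQ]
      have e1 := (signalCov_posDef (H := H) (π := π) hQ k).logDet_le
        (signalCov_posDef (H := H) (π := π) hQt k)
      have e2 := (interferenceCov_posDef (H := H) (π := π) hQt k).logDet_le
        (interferenceCov_posDef (H := H) (π := π) hQ k)
      rw [signalCov_add_smul, sub_add_cancel_left, Matrix.mul_neg, trace_neg, Complex.neg_re,
        Matrix.mul_smul, re_trace_smul] at e1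
      rw [interferenceCov_add_smul, add_sub_cancel_left, Matrix.mul_smul, re_trace_smul] at e2
      rw [signalCov_add_smul, interferenceCov_add_smul]
      have : w k * (t * ((signalCov H π Q k + (t : ℂ) • U k)⁻¹ * U k).trace.re
          - t * ((interferenceCov H π Q k)⁻¹ * V k).trace.re) ≤
          w k * (logDet (signalCov H π Q k + (t : ℂ) • U k)
            - logDet (interferenceCov H π Q k + (t : ℂ) • V k)
            - (logDet (signalCov H π Q k) - logDet (interferenceCov H π Q k))) :=
        mul_le_mul_of_nonneg_left (by linarith) (hw k)
      linarith
    have h2 := h t ht ht1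
    exact le_of_mul_le_mul_left (by linarith) ht
  have hlim : Filter.Tendsto φ (nhdsWithin 0 (Set.Ioi 0)) (nhds (φ 0)) :=
    hcont.tendsto.mono_left nhdsWithin_le_nhds
  have h0 : φ 0 ≤ c := by
    refine le_of_tendsto hlim ?_
    filter_upwards [Ioc_mem_nhdsGT (zero_lt_one' ℝ)] with t ht
    exact hle t ht.1 ht.2
  simpa [hφ] using h0

theorem isRateStationary_of_forall (hw : ∀ i, 0 ≤ w i) (hA : A.IsHermitian)
    (hQ : ∀ k, (Q k).PosSemidef)
    (h : ∀ Y : Fin K → Matrix (Fin Nt) (Fin Nt) ℂ, (∀ k, (Y k).PosSemidef) →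
      ∑ k, (rateGradient H w π Q k * Y k).trace.re ≤ ((∑ k, Y k) * A).trace.re)
    (hle : ((∑ k, Q k) * A).trace.re ≤ ∑ k, (rateGradient H w π Q k * Q k).trace.re) :
    IsRateStationary H w π A Q := by
  have hsum : ∀ Y : Fin K → Matrix (Fin Nt) (Fin Nt) ℂ,
      ∑ k, (slack H w π A Q k * Y k).trace.re
        = ((∑ k, Y k) * A).trace.re - ∑ k, (rateGradient H w π Q k * Y k).trace.re := by
    intro Y
    rw [Matrix.sum_mul, re_trace_sum, ← Finset.sum_sub_distrib]
    refine Finset.sum_congr rfl fun k _ => ?_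
    rw [slack_eq_sub_rateGradient, Matrix.sub_mul, trace_sub, Complex.sub_re, trace_mul_comm A]
  have hslack : ∀ k, (slack H w π A Q k).PosSemidef := by
    intro k
    refine posSemidef_of_re_dotProduct_nonneg ?_ fun x => ?_
    · rw [slack_eq_sub_rateGradient]
      exact hA.sub (rateGradient_isHermitian hw hQ k)
    -- Testing with a rank-one covariance for user `k` alone evaluates the quadratic form of the
    -- slack at `x`.
    · have hY : ∀ j, ((Pi.single k (vecMulVec x (star x)) :
          Fin K → Matrix (Fin Nt) (Fin Nt) ℂ) j).PosSemidef := by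
        intro j
        rcases eq_or_ne j k with rfl | hj
        · rw [Pi.single_eq_same]; exact posSemidef_vecMulVec_self_star x
        · rw [Pi.single_eq_of_ne hj]; exact PosSemidef.zero
      have h1 := hsum (Pi.single k (vecMulVec x (star x)))
      rw [Finset.sum_eq_single k (fun j _ hj => by rw [Pi.single_eq_of_ne hj]; simp) (by simp),
        Pi.single_eq_same, ← dotProduct_mulVec_eq_trace] at h1
      have h2 := h _ hY
      rw [h1]; linarith
  refine ⟨hQ, hslack, fun k => (hslack k).mul_eq_zero_of_re_trace_le (hQ k) ?_⟩
  have h1 := Finset.single_le_sum (f := fun k => (slack H w π A Q k * Q k).trace.re)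
    (fun j _ => (hslack j).re_trace_mul_nonneg (hQ j)) (Finset.mem_univ k)
  have h2 := hsum Q
  linarith

end FirstOrder

/-! ### Maximizers of the Lagrangian and comparison of encoding orders -/

section UpperBound

variable {K Nt Nr : ℕ} {H : Fin K → Matrix (Fin Nr) (Fin Nt) ℂ} {w : Fin K → ℝ}
  {π : Equiv.Perm (Fin K)} {A : Matrix (Fin Nt) (Fin Nt) ℂ}
  {Q : Fin K → Matrix (Fin Nt) (Fin Nt) ℂ}

theorem isClosed_setOf_forall_posSemidef :
    IsClosed {Q : Fin K → Matrix (Fin Nt) (Fin Nt) ℂ | ∀ k, (Q k).PosSemidef} := by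
  have : {Q : Fin K → Matrix (Fin Nt) (Fin Nt) ℂ | ∀ k, (Q k).PosSemidef}
      = ⋂ k, (fun Q => Q k) ⁻¹' {M | M.PosSemidef} := by ext; simp
  rw [this]
  exact isClosed_iInter fun k => isClosed_setOf_posSemidef.preimage (continuous_apply k)

theorem isCompact_setOf_trace_le (hA : A.PosDef) (M : ℝ) :
    IsCompact {Q : Fin K → Matrix (Fin Nt) (Fin Nt) ℂ |
      (∀ k, (Q k).PosSemidef) ∧ ((∑ k, Q k) * A).trace.re ≤ M} := by
  -- From `1 ≤ c • A` follows `tr (Q k) ≤ c * M`, which bounds every entry.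
  obtain ⟨c, hc, hcA⟩ := hA.exists_smul_sub_posSemidef (M := 1) PosSemidef.one
  have hcpt : IsCompact (Set.univ.pi fun _ : Fin K => Set.univ.pi fun _ : Fin Nt =>
      Set.univ.pi fun _ : Fin Nt => Metric.closedBall (0 : ℂ) (c * M)) :=
    isCompact_univ_pi fun _ => isCompact_univ_pi fun _ => isCompact_univ_pi fun _ =>
      isCompact_closedBall _ _
  have hbound : ∀ Q : Fin K → Matrix (Fin Nt) (Fin Nt) ℂ, (∀ k, (Q k).PosSemidef) →
      ((∑ k, Q k) * A).trace.re ≤ M → ∀ k i j, ‖Q k i j‖ ≤ c * M := by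
    intro Q hQ hM k i j
    refine ((hQ k).norm_apply_le_re_trace i j).trans ?_
    have h1 := (hQ k).re_trace_mul_nonneg hcA
    rw [Matrix.mul_sub, trace_sub, Complex.sub_re, Matrix.mul_smul, re_trace_smul,
      Matrix.mul_one] at h1
    have h2 : (Q k * A).trace.re ≤ M := by
      refine le_trans ?_ hM
      rw [Matrix.sum_mul, re_trace_sum]
      exact Finset.single_le_sum (f := fun k => (Q k * A).trace.re)
        (fun j _ => (hQ j).re_trace_mul_nonneg hA.posSemidef) (Finset.mem_univ k)
    nlinarith
  have hclosed : IsClosed {Q : Fin K → Matrix (Fin Nt) (Fin Nt) ℂ |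
      ((∑ k, Q k) * A).trace.re ≤ M} := isClosed_le (by fun_prop) continuous_const
  refine hcpt.of_isClosed_subset (isClosed_setOf_forall_posSemidef.inter hclosed) fun Q hQ k _ i _ j _ => ?_
  rw [mem_closedBall_zero_iff]
  exact hbound Q hQ.1 hQ.2 k i j

theorem continuousOn_weightedSumRate (H : Fin K → Matrix (Fin Nr) (Fin Nt) ℂ) (w : Fin K → ℝ)
    (π : Equiv.Perm (Fin K)) :
    ContinuousOn (weightedSumRate H w π) {Q | ∀ k, (Q k).PosSemidef} := by
  refine continuousOn_finsetSum _ fun k _ => continuousOn_const.mul ?_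
  have h1 : Continuous fun Q : Fin K → Matrix (Fin Nt) (Fin Nt) ℂ =>
      (signalCov H π Q k).det.re :=
    Complex.continuous_re.comp (Continuous.matrix_det (by unfold signalCov; fun_prop))
  have h2 : Continuous fun Q : Fin K → Matrix (Fin Nt) (Fin Nt) ℂ =>
      (interferenceCov H π Q k).det.re :=
    Complex.continuous_re.comp (Continuous.matrix_det (by unfold interferenceCov; fun_prop))
  refine ContinuousOn.log (h1.continuousOn.div h2.continuousOn ?_) ?_
  · exact fun Q hQ => (interferenceCov_posDef hQ k).det_re_pos.ne'
  · exact fun Q hQ => (div_pos (signalCov_posDef hQ k).det_re_pos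
      (interferenceCov_posDef hQ k).det_re_pos).ne'

theorem weightedSumRate_zero : weightedSumRate H w π 0 = 0 := by
  simp [weightedSumRate, dpcRate]

/-- The weighted sum rate grows more slowly than the transmit power. -/
theorem exists_weightedSumRate_le (hw : ∀ i, 0 ≤ w i) (hA : A.PosDef) :
    ∃ C : ℝ, ∀ Q : Fin K → Matrix (Fin Nt) (Fin Nt) ℂ, (∀ k, (Q k).PosSemidef) →
      weightedSumRate H w π Q ≤ C + ((∑ k, Q k) * A).trace.re / 2 := by
  choose c hc hcA using fun k => hA.exists_smul_sub_posSemidef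
    (posSemidef_conjTranspose_mul_self (H k))
  -- The log-determinant is bounded by its tangent at `s • 1`, whose slope is proportional to `s⁻¹`;
  -- this `s` makes the total slope in the power at most `1 / 2`.
  set s : ℝ := 1 + 2 * ∑ k, w k * c k with hs
  have hc0 : 0 ≤ ∑ k, w k * c k := Finset.sum_nonneg fun k _ => mul_nonneg (hw k) (hc k)
  have hs0 : 0 < s := by positivity
  have hsm : ((s : ℂ) • (1 : Matrix (Fin Nr) (Fin Nr) ℂ)).PosDef :=
    PosDef.one.smul (Complex.zero_lt_real.mpr hs0)
  have hsinv : ((s : ℂ) • (1 : Matrix (Fin Nr) (Fin Nr) ℂ))⁻¹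
      = ((s⁻¹ : ℝ) : ℂ) • (1 : Matrix (Fin Nr) (Fin Nr) ℂ) := by
    refine inv_eq_left_inv ?_
    rw [smul_mul_smul_comm, Matrix.one_mul, ← Complex.ofReal_mul, inv_mul_cancel₀ hs0.ne']
    simp
  refine ⟨∑ k, w k * (logDet ((s : ℂ) • (1 : Matrix (Fin Nr) (Fin Nr) ℂ)) + s⁻¹ * Nr - Nr),
    fun Q hQ => ?_⟩
  set T := ((∑ k, Q k) * A).trace.re with hT
  have hT0 : 0 ≤ T := (posSemidef_sum _ fun j _ => hQ j).re_trace_mul_nonneg hA.posSemidef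
  have h1 : ∀ k, dpcRate H π Q k ≤
      logDet ((s : ℂ) • (1 : Matrix (Fin Nr) (Fin Nr) ℂ)) + s⁻¹ * Nr - Nr + s⁻¹ * (c k * T) := by
    intro k
    rw [dpcRate_eq hQ]
    have e1 : 0 ≤ logDet (interferenceCov H π Q k) := by
      have := PosDef.one.logDet_mono (interferenceCov_posDef (H := H) (π := π) hQ k) (by
        rw [interferenceCov, add_sub_cancel_left]
        exact (posSemidef_sum _ fun j _ => hQ j).mul_mul_conjTranspose_same _)
      simpa [logDet] using this
    have e2 := (signalCov_posDef (H := H) (π := π) hQ k).logDet_le hsm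
    rw [hsinv, Matrix.mul_sub, Matrix.smul_mul, Matrix.one_mul, smul_mul_smul_comm,
      ← Complex.ofReal_mul, inv_mul_cancel₀ hs0.ne', trace_sub, Complex.sub_re, re_trace_smul] at e2
    have e3 : (signalCov H π Q k).trace.re ≤ Nr + c k * T := by
      have hS : (∑ j with π k ≤ π j, Q j).PosSemidef := posSemidef_sum _ fun j _ => hQ j
      have e4 := hS.re_trace_mul_nonneg (hcA k)
      rw [Matrix.mul_sub, trace_sub, Complex.sub_re, Matrix.mul_smul, re_trace_smul] at e4
      have e5 : ((∑ j with π k ≤ π j, Q j) * A).trace.re ≤ T := by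
        rw [hT, Matrix.sum_mul, Matrix.sum_mul, re_trace_sum, re_trace_sum]
        exact Finset.sum_le_sum_of_subset_of_nonneg (Finset.filter_subset _ _)
          fun j _ _ => (hQ j).re_trace_mul_nonneg hA.posSemidef
      have e6 : (signalCov H π Q k).trace.re
          = Nr + ((∑ j with π k ≤ π j, Q j) * ((H k)ᴴ * H k)).trace.re := by
        rw [signalCov, trace_add, trace_one, Matrix.mul_assoc, trace_mul_comm, Matrix.mul_assoc]
        simp
      rw [e6]
      have := mul_le_mul_of_nonneg_left e5 (hc k)
      linarith
    have e7 := mul_le_mul_of_nonneg_left e3 (inv_nonneg.mpr hs0.le)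
    have e8 : (((1 : ℝ) : ℂ) • (1 * 1 : Matrix (Fin Nr) (Fin Nr) ℂ)).trace.re = Nr := by simp
    rw [e8] at e2
    linarith
  have h2 : weightedSumRate H w π Q ≤ ∑ k, w k *
      (logDet ((s : ℂ) • (1 : Matrix (Fin Nr) (Fin Nr) ℂ)) + s⁻¹ * Nr - Nr + s⁻¹ * (c k * T)) :=
    Finset.sum_le_sum fun k _ => mul_le_mul_of_nonneg_left (h1 k) (hw k)
  refine h2.trans ?_
  simp only [mul_add (w _) _ (s⁻¹ * (c _ * T)), Finset.sum_add_distrib]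
  have h3 : ∑ k, w k * (s⁻¹ * (c k * T)) = s⁻¹ * (∑ k, w k * c k) * T := by
    rw [Finset.mul_sum, Finset.sum_mul]
    exact Finset.sum_congr rfl fun k _ => by ring
  have h4 : s⁻¹ * (∑ k, w k * c k) ≤ 1 / 2 := by
    rw [inv_mul_le_iff₀ hs0]; linarith
  have := mul_le_mul_of_nonneg_right h4 hT0
  rw [h3]; linarith

theorem exists_isMaxOn_lagrangian (hw : ∀ i, 0 ≤ w i) (hA : A.PosDef) :
    ∃ Q : Fin K → Matrix (Fin Nt) (Fin Nt) ℂ, (∀ k, (Q k).PosSemidef) ∧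
      ∀ Y : Fin K → Matrix (Fin Nt) (Fin Nt) ℂ, (∀ k, (Y k).PosSemidef) →
        weightedSumRate H w π Y - ((∑ k, Y k) * A).trace.re
          ≤ weightedSumRate H w π Q - ((∑ k, Q k) * A).trace.re := by
  obtain ⟨C, hC⟩ := exists_weightedSumRate_le (H := H) (π := π) hw hA
  -- The Lagrangian is at most `C` minus half the power, hence negative once the power exceeds `2 *
  -- C`, whereas it is `0` at the origin. The compact set up to that power suffices.
  have h0 : (0 : Fin K → Matrix (Fin Nt) (Fin Nt) ℂ) ∈
      {Q : Fin K → Matrix (Fin Nt) (Fin Nt) ℂ |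
        (∀ k, (Q k).PosSemidef) ∧ ((∑ k, Q k) * A).trace.re ≤ 2 * C} := by
    refine ⟨fun _ => PosSemidef.zero, ?_⟩
    have := hC 0 fun _ => PosSemidef.zero
    rw [weightedSumRate_zero] at this
    simp only [Pi.zero_apply, Finset.sum_const_zero, Matrix.zero_mul, trace_zero,
      Complex.zero_re] at this ⊢
    linarith
  have hcont : ContinuousOn (fun Q => weightedSumRate H w π Q - ((∑ k, Q k) * A).trace.re)
      {Q : Fin K → Matrix (Fin Nt) (Fin Nt) ℂ |
        (∀ k, (Q k).PosSemidef) ∧ ((∑ k, Q k) * A).trace.re ≤ 2 * C} := by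
    refine ((continuousOn_weightedSumRate H w π).mono fun Q hQ => hQ.1).sub
      (Continuous.continuousOn (by fun_prop))
  obtain ⟨Q, hQ, hmax⟩ := (isCompact_setOf_trace_le hA (2 * C)).exists_isMaxOn ⟨0, h0⟩ hcont
  refine ⟨Q, hQ.1, fun Y hY => ?_⟩
  by_cases hYC : ((∑ k, Y k) * A).trace.re ≤ 2 * C
  · exact hmax ⟨hY, hYC⟩
  · have h1 := hmax h0
    have h2 := hC Y hY
    simp only [Set.mem_ofPred_eq, weightedSumRate_zero, Pi.zero_apply, Finset.sum_const_zero,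
      Matrix.zero_mul, trace_zero, Complex.zero_re] at h1
    push Not at hYC
    linarith

theorem exists_isRateStationary_isMax (hw : ∀ i, 0 ≤ w i) (hA : A.PosDef) :
    ∃ Q : Fin K → Matrix (Fin Nt) (Fin Nt) ℂ, IsRateStationary H w π A Q ∧
      ∀ Y : Fin K → Matrix (Fin Nt) (Fin Nt) ℂ, (∀ k, (Y k).PosSemidef) →
        weightedSumRate H w π Y - ((∑ k, Y k) * A).trace.re
          ≤ weightedSumRate H w π Q - ((∑ k, Q k) * A).trace.re := by
  obtain ⟨Q, hQ, hmax⟩ := exists_isMaxOn_lagrangian (H := H) (π := π) hw hA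
  refine ⟨Q, ?_, hmax⟩
  have key : ∀ Y : Fin K → Matrix (Fin Nt) (Fin Nt) ℂ, (∀ k, (Y k).PosSemidef) →
      ∑ k, (rateGradient H w π Q k * (Y - Q) k).trace.re ≤ ((∑ k, (Y - Q) k) * A).trace.re := by
    intro Y hY
    have hmem : ∀ t : ℝ, 0 < t → t ≤ 1 → ∀ k, ((Q + (t : ℂ) • (Y - Q)) k).PosSemidef := by
      intro t ht ht1 k
      have : (Q + (t : ℂ) • (Y - Q)) k = ((1 - t : ℝ) : ℂ) • Q k + (t : ℂ) • Y k := by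
        simp only [Pi.add_apply, Pi.smul_apply, Pi.sub_apply]
        push_cast
        module
      rw [this]
      exact (posSemidef_ofReal_smul (hQ k) (by linarith)).add
        (posSemidef_ofReal_smul (hY k) ht.le)
    refine sum_rateGradient_le_of_forall hw hQ hmem fun t ht ht1 => ?_
    have h := hmax _ (hmem t ht ht1)
    have e : ((∑ k, (Q + (t : ℂ) • (Y - Q)) k) * A).trace.re
        = ((∑ k, Q k) * A).trace.re + t * ((∑ k, (Y - Q) k) * A).trace.re := by
      simp only [Pi.add_apply, Pi.smul_apply, Finset.sum_add_distrib, ← Finset.smul_sum,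
        Matrix.add_mul, Matrix.smul_mul, trace_add, Complex.add_re, re_trace_smul]
    linarith
  have hlin : ∀ Y : Fin K → Matrix (Fin Nt) (Fin Nt) ℂ,
      ∑ k, (rateGradient H w π Q k * (Y - Q) k).trace.re - ((∑ k, (Y - Q) k) * A).trace.re
      = (∑ k, (rateGradient H w π Q k * Y k).trace.re - ((∑ k, Y k) * A).trace.re)
        - (∑ k, (rateGradient H w π Q k * Q k).trace.re - ((∑ k, Q k) * A).trace.re) := by
    intro Y
    simp only [Pi.sub_apply, Matrix.mul_sub, Finset.sum_sub_distrib, Matrix.sub_mul, trace_sub,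
      Complex.sub_re]
    ring
  have hle : ∀ Y : Fin K → Matrix (Fin Nt) (Fin Nt) ℂ, (∀ k, (Y k).PosSemidef) →
      ∑ k, (rateGradient H w π Q k * Y k).trace.re - ((∑ k, Y k) * A).trace.re
        ≤ ∑ k, (rateGradient H w π Q k * Q k).trace.re - ((∑ k, Q k) * A).trace.re := by
    intro Y hY
    have h1 := key Y hY
    have h2 := hlin Y
    linarith
  -- On a cone, comparing the maximizer of a linear functional with `0` and with `2 • Q` forces its
  -- value to be zero.
  have h0 := hle 0 fun _ => PosSemidef.zero
  have h2 := hle (((2 : ℝ) : ℂ) • Q) fun k => posSemidef_ofReal_smul (hQ k) (by norm_num)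
  simp only [Pi.zero_apply, Finset.sum_const_zero, Matrix.mul_zero, Matrix.zero_mul, trace_zero,
    Complex.zero_re, sub_zero] at h0
  simp only [Pi.smul_apply, Matrix.mul_smul, re_trace_smul, ← Finset.smul_sum, Matrix.smul_mul,
    ← Finset.mul_sum] at h2
  refine isRateStationary_of_forall hw hA.1 hQ (fun Y hY => ?_) (by linarith)
  have := hle Y hY
  linarith

/-- Stationary covariances for an order with decreasing weights maximize the Lagrangian of the
weighted sum rate over all encoding orders. -/
theorem IsRateStationary.lagrangian_le_of_posDef (hs : IsRateStationary H w π A Q)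
    (hw : ∀ i, 0 ≤ w i) (hπ : ∀ i j, π i ≤ π j → w j ≤ w i) (hA : A.PosDef)
    (π' : Equiv.Perm (Fin K)) {Y : Fin K → Matrix (Fin Nt) (Fin Nt) ℂ}
    (hY : ∀ k, (Y k).PosSemidef) :
    weightedSumRate H w π' Y - ((∑ k, Y k) * A).trace.re
      ≤ weightedSumRate H w π Q - ((∑ k, Q k) * A).trace.re := by
  obtain ⟨Z, hZ, hmax⟩ := exists_isRateStationary_isMax (H := H) (π := π') hw hA
  have hX := dualCov_posSemidef (H := H) (π := π') hw hZ.posSemidef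
  refine (hmax Y hY).trans (le_trans ?_ (hs.sum_weight_macRate_sub_le hw hπ hA hX))
  rw [hZ.weightedSumRate_eq hw hA, ← hZ.sum_trace_dualCov, Complex.re_sum]
  have := sum_weight_macRate_le (H := H) hw hπ hA hX π'
  linarith

theorem signalCov_conj {p : Matrix (Fin Nt) (Fin Nt) ℂ} (hp : p.IsHermitian)
    (hH : ∀ k, H k * p = H k) (k : Fin K) :
    signalCov H π (fun j => p * Q j * p) k = signalCov H π Q k := by
  have hH' : p * (H k)ᴴ = (H k)ᴴ := by
    rw [← hp.eq, ← conjTranspose_mul, hH]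
  rw [signalCov, signalCov, ← Finset.sum_mul, ← Finset.mul_sum, ← Matrix.mul_assoc,
    ← Matrix.mul_assoc, hH, Matrix.mul_assoc _ p, hH']

theorem interferenceCov_conj {p : Matrix (Fin Nt) (Fin Nt) ℂ} (hp : p.IsHermitian)
    (hH : ∀ k, H k * p = H k) (k : Fin K) :
    interferenceCov H π (fun j => p * Q j * p) k = interferenceCov H π Q k := by
  have hH' : p * (H k)ᴴ = (H k)ᴴ := by
    rw [← hp.eq, ← conjTranspose_mul, hH]
  rw [interferenceCov, interferenceCov, ← Finset.sum_mul, ← Finset.mul_sum, ← Matrix.mul_assoc,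
    ← Matrix.mul_assoc, hH, Matrix.mul_assoc _ p, hH']

theorem weightedSumRate_conj {p : Matrix (Fin Nt) (Fin Nt) ℂ} (hp : p.IsHermitian)
    (hH : ∀ k, H k * p = H k) :
    weightedSumRate H w π (fun j => p * Q j * p) = weightedSumRate H w π Q := by
  refine Finset.sum_congr rfl fun k _ => ?_
  have h1 := signalCov_conj (π := π) (Q := Q) hp hH k
  have h2 := interferenceCov_conj (π := π) (Q := Q) hp hH k
  rw [signalCov, signalCov] at h1
  rw [interferenceCov, interferenceCov] at h2
  rw [dpcRate, dpcRate, h1, h2]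

theorem trace_sum_conj_mul {p B : Matrix (Fin Nt) (Fin Nt) ℂ}
    (hB : p * B * p = B) : ((∑ k, p * Q k * p) * B).trace = ((∑ k, Q k) * B).trace := by
  rw [← Finset.sum_mul, ← Finset.mul_sum, Matrix.mul_assoc, Matrix.mul_assoc, trace_mul_comm,
    Matrix.mul_assoc, Matrix.mul_assoc, ← Matrix.mul_assoc p B, hB]

theorem posSemidef_conj {p : Matrix (Fin Nt) (Fin Nt) ℂ} (hp : p.IsHermitian)
    (hQ : ∀ k, (Q k).PosSemidef) (k : Fin K) : (p * Q k * p).PosSemidef := by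
  have := (hQ k).mul_mul_conjTranspose_same p
  rwa [hp.eq] at this

/-- The channels of all users vanish on the kernel of the noise covariance. -/
theorem IsRateStationary.mulVec_eq_zero (hs : IsRateStationary H w π A Q) (hw : ∀ i, 0 < w i)
    {v : Fin Nt → ℂ} (hv : A *ᵥ v = 0) (k : Fin K) : H k *ᵥ v = 0 := by
  have key : ∀ n : ℕ, ∀ k, (π k : ℕ) = n → H k *ᵥ v = 0 := by
    intro n
    induction n using Nat.strong_induction_on with
    | _ n ih =>
      intro k hk
      -- By induction the users at earlier positions do not see `v`. The slack of user `k` at `v` is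
      -- then minus a quadratic form, so it is nonnegative only if `H k *ᵥ v = 0`.
      have hmac : macCov A H (dualCov H w π Q) (firstUsers π (π k)) *ᵥ v = 0 := by
        rw [macCov, add_mulVec, hv, zero_add, sum_mulVec]
        refine Finset.sum_eq_zero fun j hj => ?_
        rw [← mulVec_mulVec, ih (π j) (hk ▸ mem_firstUsers.mp hj) j rfl, mulVec_zero]
      have hR := (signalCov_posDef (H := H) (π := π) hs.posSemidef k).inv
      have h := (hs.slack_posSemidef k).re_dotProduct_nonneg v
      rw [slack, sub_mulVec, hmac, zero_sub, dotProduct_neg, smul_mulVec, dotProduct_smul,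
        ← mulVec_mulVec, ← mulVec_mulVec, dotProduct_mulVec, ← star_mulVec] at h
      by_contra hne
      have h2 := hR.re_dotProduct_pos hne
      simp only [RCLike.re_to_complex, Complex.neg_re, smul_eq_mul, Complex.re_ofReal_mul] at h h2
      nlinarith [mul_pos (hw k) h2]
  exact key _ k rfl

theorem IsRateStationary.lagrangian_le (hs : IsRateStationary H w π A Q)
    (hw : ∀ i, 0 < w i) (hπ : ∀ i j, π i ≤ π j → w j ≤ w i) (hA : A.PosSemidef)
    (π' : Equiv.Perm (Fin K)) {Y : Fin K → Matrix (Fin Nt) (Fin Nt) ℂ}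
    (hY : ∀ k, (Y k).PosSemidef) :
    weightedSumRate H w π' Y - ((∑ k, Y k) * A).trace.re
      ≤ weightedSumRate H w π Q - ((∑ k, Q k) * A).trace.re := by
  obtain ⟨p, hp, hpp, hAp, hp1, hpA⟩ := hA.exists_support_projection
  have hH : ∀ k, H k * p = H k := fun k =>
    mul_eq_self_of_ker_le hAp fun v hv => hs.mulVec_eq_zero hw hv k
  have hpA' : p * A = A := by
    have := congrArg conjTranspose hAp
    rwa [conjTranspose_mul, hp.eq, hA.1.eq] at this
  have hconj : ∀ Z : Fin K → Matrix (Fin Nt) (Fin Nt) ℂ,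
      ((∑ k, p * Z k * p) * (A + (1 - p))).trace = ((∑ k, Z k) * A).trace := by
    intro Z
    have h0 : (∑ k, p * Z k * p) * (1 - p) = 0 := by
      rw [← Finset.sum_mul, Matrix.mul_assoc, Matrix.mul_sub, Matrix.mul_one, hpp, sub_self,
        Matrix.mul_zero]
    rw [Matrix.mul_add, h0, add_zero, trace_sum_conj_mul (by rw [hpA', hAp])]
  have hX : dualCov H w π (fun k => p * Q k * p) = dualCov H w π Q := by
    ext1 k
    rw [dualCov, dualCov, signalCov_conj hp hH, interferenceCov_conj hp hH]
  have hslack : ∀ k, slack H w π (A + (1 - p)) (fun k => p * Q k * p) k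
      = slack H w π A Q k + (1 - p) := by
    intro k
    rw [slack, slack, hX, signalCov_conj hp hH, macCov, macCov]
    abel
  have hslackp : ∀ k, slack H w π A Q k * p = slack H w π A Q k := by
    intro k
    rw [slack, macCov, Matrix.sub_mul, Matrix.add_mul, hAp, Finset.sum_mul, Matrix.smul_mul,
      Matrix.mul_assoc _ (H k), hH]
    simp only [Matrix.mul_assoc, hH]
  -- Adding `1 - p` makes the noise covariance definite, and projected covariances do not notice it:
  -- rates, power and complementary slackness are unchanged.
  have hs' : IsRateStationary H w π (A + (1 - p)) (fun k => p * Q k * p) := by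
    refine ⟨posSemidef_conj hp hs.posSemidef, fun k => ?_, fun k => ?_⟩
    · rw [hslack]
      exact (hs.slack_posSemidef k).add hp1
    · rw [hslack, Matrix.add_mul, ← Matrix.mul_assoc, ← Matrix.mul_assoc, hslackp, hs.slack_mul,
        ← Matrix.mul_assoc, ← Matrix.mul_assoc, Matrix.sub_mul, hpp]
      simp
  have h := hs'.lagrangian_le_of_posDef (fun i => (hw i).le) hπ hpA π' (posSemidef_conj hp hY)
  rwa [hconj, hconj, weightedSumRate_conj hp hH, weightedSumRate_conj hp hH] at h

end UpperBound

/-! ### Lagrange multipliers by separation -/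

section Multipliers

/-- Lagrange multipliers for a linear program over a convex cone with two inequality
constraints that hold strictly at the origin. -/
theorem exists_lagrange_multipliers {V : Type*} [AddCommGroup V] [Module ℝ V] {C : Set V}
    (hC : Convex ℝ C) (h0 : (0 : V) ∈ C) (hsmul : ∀ t : ℝ, 0 ≤ t → ∀ x ∈ C, t • x ∈ C)
    (L a₁ a₂ : V →ₗ[ℝ] ℝ) {P₁ P₂ : ℝ} (hP₁ : 0 < P₁) (hP₂ : 0 < P₂) {q : V} (hq : q ∈ C)
    (hq₁ : a₁ q ≤ P₁) (hq₂ : a₂ q ≤ P₂)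
    (hmax : ∀ x ∈ C, a₁ x ≤ P₁ → a₂ x ≤ P₂ → L x ≤ L q) :
    ∃ l₁ l₂ : ℝ, 0 ≤ l₁ ∧ 0 ≤ l₂ ∧ (∀ x ∈ C, L x ≤ l₁ * a₁ x + l₂ * a₂ x) ∧
      L q = l₁ * P₁ + l₂ * P₂ ∧ l₁ * a₁ q + l₂ * a₂ q = l₁ * P₁ + l₂ * P₂ := by
  -- A point of the open octant in the image `T` would be a strictly feasible improvement on `q`.
  set S : Set (ℝ × ℝ × ℝ) := Set.Ioi 0 ×ˢ Set.Ioi 0 ×ˢ Set.Ioi 0 with hS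
  set F : V →ₗ[ℝ] ℝ × ℝ × ℝ := L.prod ((-a₁).prod (-a₂)) with hF
  set T : Set (ℝ × ℝ × ℝ) := (fun y => (-L q, P₁, P₂) + y) '' (F '' C) with hT
  have hFx : ∀ x, (-L q, P₁, P₂) + F x = (L x - L q, P₁ - a₁ x, P₂ - a₂ x) := fun x =>
    Prod.ext (neg_add_eq_sub _ _) (Prod.ext (sub_eq_add_neg _ _).symm (sub_eq_add_neg _ _).symm)
  have hSo : IsOpen S := isOpen_Ioi.prod (isOpen_Ioi.prod isOpen_Ioi)
  have hSc : Convex ℝ S := (convex_Ioi 0).prod ((convex_Ioi 0).prod (convex_Ioi 0))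
  have hTc : Convex ℝ T := (hC.linear_image F).translate _
  have hdisj : Disjoint S T := by
    rw [Set.disjoint_left]
    rintro z hz ⟨-, ⟨x, hx, rfl⟩, rfl⟩
    simp only [hS, hFx, Set.mem_prod, Set.mem_Ioi] at hz
    obtain ⟨hz1, hz2, hz3⟩ := hz
    have := hmax x hx (by linarith) (by linarith)
    linarith
  obtain ⟨f, u, hfS, hfT⟩ := geometric_hahn_banach_open hSc hSo hTc hdisj
  set α := f (1, 0, 0) with hα
  set β := f (0, 1, 0) with hβ
  set γ := f (0, 0, 1) with hγ
  have hf : ∀ x y z : ℝ, f (x, y, z) = α * x + β * y + γ * z := by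
    intro x y z
    have : (x, y, z) = x • ((1, 0, 0) : ℝ × ℝ × ℝ) + y • ((0, 1, 0) : ℝ × ℝ × ℝ)
        + z • ((0, 0, 1) : ℝ × ℝ × ℝ) := by simp
    rw [this, map_add, map_add, map_smul, map_smul, map_smul, smul_eq_mul, smul_eq_mul,
      smul_eq_mul]
    ring
  have hpos : ∀ x y z : ℝ, 0 < x → 0 < y → 0 < z → α * x + β * y + γ * z < u := by
    intro x y z hx hy hz
    rw [← hf]
    exact hfS _ ⟨hx, hy, hz⟩
  have hval : ∀ x ∈ C, u ≤ α * (L x - L q) + β * (P₁ - a₁ x) + γ * (P₂ - a₂ x) := by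
    intro x hx
    have := hfT _ ⟨_, ⟨x, hx, rfl⟩, rfl⟩
    simpa only [hFx, hf] using this
  have hneg : ∀ δ ε η : ℝ, (∀ t : ℝ, 0 < t → δ * t + ε * 1 + η * 1 < u) → δ ≤ 0 := by
    intro δ ε η h
    by_contra! hδ
    have ht : 0 < (|u - ε - η| + 1) / δ := by positivity
    have := h _ ht
    rw [mul_div_cancel₀ _ hδ.ne'] at this
    linarith [le_abs_self (u - ε - η)]
  have hα0 : α ≤ 0 := hneg α β γ fun t ht => hpos t 1 1 ht one_pos one_pos
  have hβ0 : β ≤ 0 := hneg β α γ fun t ht => by linarith [hpos 1 t 1 one_pos ht one_pos]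
  have hγ0 : γ ≤ 0 := hneg γ α β fun t ht => by linarith [hpos 1 1 t one_pos one_pos ht]
  have hu : 0 ≤ u := by
    have hlim : Filter.Tendsto (fun t : ℝ => α * t + β * t + γ * t)
        (nhdsWithin 0 (Set.Ioi 0)) (nhds (α * 0 + β * 0 + γ * 0)) :=
      (Continuous.tendsto (by fun_prop) 0).mono_left nhdsWithin_le_nhds
    have := le_of_tendsto hlim (b := u) (by
      filter_upwards [self_mem_nhdsWithin] with t ht
      exact (hpos t t t ht ht ht).le)
    simpa using this
  -- This is Slater's condition: with `α = 0`, the origin gives `u ≤ β * P₁ + γ * P₂`, contradicting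
  -- strict separation at `(1, P₁, P₂)`.
  have hαneg : α < 0 := by
    refine lt_of_le_of_ne hα0 fun h => ?_
    have h1 := hval 0 h0
    have h2 := hpos 1 P₁ P₂ one_pos hP₁ hP₂
    simp only [h, map_zero, sub_zero, zero_mul, zero_add] at h1 h2
    linarith
  have hmul : ∀ l c : ℝ, l = c / α → l * α = c := fun l c h => by
    rw [h, div_mul_cancel₀ _ hαneg.ne]
  obtain ⟨l₁, hl₁⟩ : ∃ l, l = β / α := ⟨_, rfl⟩
  obtain ⟨l₂, hl₂⟩ : ∃ l, l = γ / α := ⟨_, rfl⟩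
  have hl₁0 : 0 ≤ l₁ := hl₁ ▸ div_nonneg_of_nonpos hβ0 hα0
  have hl₂0 : 0 ≤ l₂ := hl₂ ▸ div_nonneg_of_nonpos hγ0 hα0
  have e₁ := hmul _ _ hl₁
  have e₂ := hmul _ _ hl₂
  have hval' : ∀ x ∈ C, (L x - L q) + l₁ * (P₁ - a₁ x) + l₂ * (P₂ - a₂ x) ≤ 0 := by
    intro x hx
    have h1 := hval x hx
    rw [← e₁, ← e₂] at h1
    by_contra! h2
    nlinarith
  have hq' := hval' q hq
  have hs₁ : 0 ≤ l₁ * (P₁ - a₁ q) := mul_nonneg hl₁0 (by linarith)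
  have hs₂ : 0 ≤ l₂ * (P₂ - a₂ q) := mul_nonneg hl₂0 (by linarith)
  -- Scaling a violating `x` far along its ray would exceed the constant terms in `hval'`.
  have hcone : ∀ x ∈ C, L x ≤ l₁ * a₁ x + l₂ * a₂ x := by
    intro x hx
    by_contra! h
    set d := L x - (l₁ * a₁ x + l₂ * a₂ x) with hd
    have hd0 : 0 < d := by rw [hd]; linarith
    have ht : 0 ≤ (|L q - l₁ * P₁ - l₂ * P₂| + 1) / d := by positivity
    have h1 := hval' _ (hsmul _ ht x hx)
    simp only [map_smul, smul_eq_mul] at h1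
    have h2 : (|L q - l₁ * P₁ - l₂ * P₂| + 1) / d * d = |L q - l₁ * P₁ - l₂ * P₂| + 1 :=
      div_mul_cancel₀ _ hd0.ne'
    have h3 := le_abs_self (L q - l₁ * P₁ - l₂ * P₂)
    have h4 : (|L q - l₁ * P₁ - l₂ * P₂| + 1) / d * L x
        - l₁ * ((|L q - l₁ * P₁ - l₂ * P₂| + 1) / d * a₁ x)
        - l₂ * ((|L q - l₁ * P₁ - l₂ * P₂| + 1) / d * a₂ x)
        = (|L q - l₁ * P₁ - l₂ * P₂| + 1) / d * d := by rw [hd]; ring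
    linarith
  have h0' := hval' 0 h0
  simp only [map_zero, sub_zero, zero_sub] at h0'
  have hcq := hcone q hq
  refine ⟨l₁, l₂, hl₁0, hl₂0, hcone, by linarith, by linarith⟩

end Multipliers

/-! ### Strong duality for the optimal rates -/

section Optimum

variable {K Nt Nr : ℕ} {H : Fin K → Matrix (Fin Nr) (Fin Nt) ℂ} {w : Fin K → ℝ}
  {π : Equiv.Perm (Fin K)} {A₁ A₂ : Matrix (Fin Nt) (Fin Nt) ℂ} {P₁ P₂ l₁ l₂ : ℝ}

theorem orderOptimum_mono {C D : Set (Matrix (Fin Nt) (Fin Nt) ℂ)} (h : C ⊆ D) :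
    orderOptimum H w π C ≤ orderOptimum H w π D :=
  biSup_mono fun _ hQ => ⟨hQ.1, h hQ.2⟩

theorem orderOptimum_le_bcOptimum (C : Set (Matrix (Fin Nt) (Fin Nt) ℂ)) :
    orderOptimum H w π C ≤ bcOptimum H w C :=
  le_iSup (fun π => orderOptimum H w π C) π

theorem bcOptimum_mono {C D : Set (Matrix (Fin Nt) (Fin Nt) ℂ)} (h : C ⊆ D) :
    bcOptimum H w C ≤ bcOptimum H w D :=
  iSup_mono fun _ => orderOptimum_mono h

theorem twoConstraints_subset (h₁ : 0 ≤ l₁) (h₂ : 0 ≤ l₂) :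
    twoConstraints A₁ A₂ P₁ P₂ ⊆ aggregatedConstraint A₁ A₂ P₁ P₂ l₁ l₂ := fun _ hQ =>
  add_le_add (mul_le_mul_of_nonneg_left hQ.1 h₁) (mul_le_mul_of_nonneg_left hQ.2 h₂)

theorem Matrix.PosSemidef.mulVec_eq_zero_of_add {n : Type*} [Fintype n] {A B : Matrix n n ℂ}
    (hA : A.PosSemidef) (hB : B.PosSemidef) {v : n → ℂ} (h : (A + B) *ᵥ v = 0) : A *ᵥ v = 0 := by
  rw [← hA.dotProduct_mulVec_zero_iff]
  have h1 := hA.dotProduct_mulVec_nonneg v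
  have h2 := hB.dotProduct_mulVec_nonneg v
  have h3 : star v ⬝ᵥ (A *ᵥ v) + star v ⬝ᵥ (B *ᵥ v) = 0 := by
    rw [← dotProduct_add, ← add_mulVec, h, dotProduct_zero]
  exact ((add_eq_zero_iff_of_nonneg h1 h2).mp h3).1

/-- The rate is unbounded if some direction is seen by a user but not limited by the
constraints. -/
theorem orderOptimum_eq_top (hw : ∀ i, 0 < w i) (hA₁ : A₁.PosSemidef) (hA₂ : A₂.PosSemidef)
    (hP₁ : 0 < P₁) (hP₂ : 0 < P₂) {v : Fin Nt → ℂ} (hv : (A₁ + A₂) *ᵥ v = 0) {i : Fin K}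
    (hi : H i *ᵥ v ≠ 0) : orderOptimum H w π (twoConstraints A₁ A₂ P₁ P₂) = ⊤ := by
  rw [EReal.eq_top_iff_forall_lt]
  intro y
  have hv₁ := hA₁.mulVec_eq_zero_of_add hA₂ hv
  have hv₂ := hA₂.mulVec_eq_zero_of_add hA₁ (by rwa [add_comm])
  set V := vecMulVec v (star v) with hV
  set u := H i *ᵥ v with hu
  have hs : 0 < (star u ⬝ᵥ u).re :=
    (Complex.lt_def.mp (dotProduct_star_self_pos_iff.mpr hi)).1
  set s := (star u ⬝ᵥ u).re with hsdef
  have hse : star u ⬝ᵥ u = (s : ℂ) :=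
    Complex.ext rfl (Complex.lt_def.mp (dotProduct_star_self_pos_iff.mpr hi)).2.symm
  -- The beam `t • V` costs nothing in either constraint and gives user `i` the rate `log (1 + t *
  -- s)`; this `t` makes the weighted rate at least `y + 1`.
  set t := Real.exp ((y + 1) / w i) / s with ht
  have ht0 : 0 < t := by positivity
  set Q : Fin K → Matrix (Fin Nt) (Fin Nt) ℂ := Pi.single i ((t : ℂ) • V) with hQ
  have hQi : Q i = (t : ℂ) • V := Pi.single_eq_same _ _
  have hQj : ∀ j, j ≠ i → Q j = 0 := fun j hj => Pi.single_eq_of_ne hj _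
  have hpsd : ∀ j, (Q j).PosSemidef := by
    intro j
    rcases eq_or_ne j i with rfl | hj
    · rw [hQi]; exact posSemidef_ofReal_smul (posSemidef_vecMulVec_self_star v) ht0.le
    · rw [hQj j hj]; exact PosSemidef.zero
  have hsum : ∑ j, Q j = (t : ℂ) • V := by
    rw [Finset.sum_eq_single i (fun j _ hj => hQj j hj) (by simp), hQi]
  have htr : ∀ B : Matrix (Fin Nt) (Fin Nt) ℂ, B *ᵥ v = 0 → ((∑ j, Q j) * B).trace.re = 0 := by
    intro B hB
    rw [hsum, Matrix.smul_mul, re_trace_smul, trace_mul_comm, ← dotProduct_mulVec_eq_trace, hB]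
    simp
  have hfeas : Q ∈ feasible K (twoConstraints A₁ A₂ P₁ P₂) :=
    ⟨hpsd, by rw [htr _ hv₁]; exact hP₁.le, by rw [htr _ hv₂]; exact hP₂.le⟩
  have hrate : ∀ j, j ≠ i → dpcRate H π Q j = 0 := by
    intro j hj
    rw [dpcRate_eq hpsd, signalCov_eq, hQj j hj]
    simp
  have hint : interferenceCov H π Q i = 1 := by
    rw [interferenceCov, Finset.sum_eq_zero fun j hj => hQj j ?_]
    · simp
    · rintro rfl; simp at hj
  have hdet : (signalCov H π Q i).det.re = 1 + t * s := by
    have : signalCov H π Q i = 1 + replicateCol Unit ((t : ℂ) • u) * replicateRow Unit (star u) := by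
      rw [signalCov_eq, hint, hQi, hV, Matrix.mul_smul, Matrix.smul_mul, mul_vecMulVec,
        vecMulVec_mul, ← star_mulVec, ← hu, vecMulVec_eq Unit]
      rw [replicateCol_smul, Matrix.smul_mul]
    rw [this, det_one_add_replicateCol_mul_replicateRow, dotProduct_smul, hse]
    simp
  have hval : weightedSumRate H w π Q = w i * Real.log (1 + t * s) := by
    rw [weightedSumRate, Finset.sum_eq_single i (fun j _ hj => by rw [hrate j hj, mul_zero])
      (by simp), dpcRate_eq hpsd, hint, logDet, hdet]
    simp [logDet]
  have hlt : y < weightedSumRate H w π Q := by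
    have h1 : t * s = Real.exp ((y + 1) / w i) := div_mul_cancel₀ _ hs.ne'
    have h2 : (y + 1) / w i ≤ Real.log (1 + t * s) := by
      rw [h1, Real.le_log_iff_exp_le (by positivity)]
      linarith
    have h3 := mul_le_mul_of_nonneg_left h2 (hw i).le
    rw [mul_div_cancel₀ _ (hw i).ne'] at h3
    rw [hval]; linarith
  exact (EReal.coe_lt_coe_iff.mpr hlt).trans_le
    (le_iSup₂ (f := fun Q _ => (weightedSumRate H w π Q : EReal)) Q hfeas)

/-- The pairing of tuples of matrices as a real linear functional. -/
def tracePairing (G : Fin K → Matrix (Fin Nt) (Fin Nt) ℂ) :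
    (Fin K → Matrix (Fin Nt) (Fin Nt) ℂ) →ₗ[ℝ] ℝ where
  toFun Q := ∑ k, (G k * Q k).trace.re
  map_add' Q Y := by
    simp only [Pi.add_apply, Matrix.mul_add, trace_add, Complex.add_re, Finset.sum_add_distrib]
  map_smul' t Q := by
    simp only [Pi.smul_apply, ← Complex.coe_smul, Matrix.mul_smul, re_trace_smul, Finset.mul_sum,
      RingHom.id_apply, smul_eq_mul]

theorem tracePairing_const (B : Matrix (Fin Nt) (Fin Nt) ℂ)
    (Q : Fin K → Matrix (Fin Nt) (Fin Nt) ℂ) :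
    tracePairing (fun _ => B) Q = ((∑ k, Q k) * B).trace.re := by
  rw [Matrix.sum_mul, re_trace_sum]
  change ∑ k, (B * Q k).trace.re = _
  exact Finset.sum_congr rfl fun k _ => by rw [trace_mul_comm]

/-- Optimal covariances exist if the constraints bound the transmit power, and they are stationary
for suitable multipliers. -/
theorem exists_isRateStationary_of_posDef_add (hw : ∀ i, 0 ≤ w i) (hA₁ : A₁.PosSemidef)
    (hA₂ : A₂.PosSemidef) (hA : (A₁ + A₂).PosDef) (hP₁ : 0 < P₁) (hP₂ : 0 < P₂) :
    ∃ Q ∈ feasible K (twoConstraints A₁ A₂ P₁ P₂), ∃ l₁ l₂ : ℝ, 0 ≤ l₁ ∧ 0 ≤ l₂ ∧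
      IsRateStationary H w π ((l₁ : ℂ) • A₁ + (l₂ : ℂ) • A₂) Q ∧
      ((∑ k, Q k) * ((l₁ : ℂ) • A₁ + (l₂ : ℂ) • A₂)).trace.re = l₁ * P₁ + l₂ * P₂ := by
  set S := feasible K (twoConstraints A₁ A₂ P₁ P₂) with hS
  have hcpt : IsCompact S := by
    refine (isCompact_setOf_trace_le hA (P₁ + P₂)).of_isClosed_subset ?_ ?_
    · have : S = {Q : Fin K → Matrix (Fin Nt) (Fin Nt) ℂ | ∀ k, (Q k).PosSemidef} ∩
          ({Q | ((∑ k, Q k) * A₁).trace.re ≤ P₁} ∩ {Q | ((∑ k, Q k) * A₂).trace.re ≤ P₂}) := rfl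
      rw [this]
      exact isClosed_setOf_forall_posSemidef.inter
        ((isClosed_le (by fun_prop) continuous_const).inter
          (isClosed_le (by fun_prop) continuous_const))
    · intro Q hQ
      refine ⟨hQ.1, ?_⟩
      rw [Matrix.mul_add, trace_add, Complex.add_re]
      exact add_le_add hQ.2.1 hQ.2.2
  have h0 : (0 : Fin K → Matrix (Fin Nt) (Fin Nt) ℂ) ∈ S :=
    ⟨fun _ => PosSemidef.zero, by simp [hP₁.le], by simp [hP₂.le]⟩
  obtain ⟨Q, hQ, hmax⟩ := hcpt.exists_isMaxOn ⟨0, h0⟩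
    ((continuousOn_weightedSumRate H w π).mono fun Q hQ => hQ.1)
  have hlin : ∀ Y : Fin K → Matrix (Fin Nt) (Fin Nt) ℂ, (∀ k, (Y k).PosSemidef) →
      tracePairing (fun _ => A₁) Y ≤ P₁ → tracePairing (fun _ => A₂) Y ≤ P₂ →
      tracePairing (rateGradient H w π Q) Y ≤ tracePairing (rateGradient H w π Q) Q := by
    intro Y hY h₁ h₂
    rw [tracePairing_const] at h₁ h₂
    have hmem : ∀ t : ℝ, 0 < t → t ≤ 1 → Q + (t : ℂ) • (Y - Q) ∈ S := by
      intro t ht ht1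
      have he : Q + (t : ℂ) • (Y - Q) = ((1 - t : ℝ) : ℂ) • Q + (t : ℂ) • Y := by
        push_cast
        module
      rw [he]
      have htr : ∀ B : Matrix (Fin Nt) (Fin Nt) ℂ,
          ((∑ k, (((1 - t : ℝ) : ℂ) • Q + (t : ℂ) • Y) k) * B).trace.re
          = (1 - t) * ((∑ k, Q k) * B).trace.re + t * ((∑ k, Y k) * B).trace.re := by
        intro B
        simp only [Pi.add_apply, Pi.smul_apply, Finset.sum_add_distrib, ← Finset.smul_sum,
          Matrix.add_mul, Matrix.smul_mul, trace_add, Complex.add_re, re_trace_smul]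
      refine ⟨fun k => (posSemidef_ofReal_smul (hQ.1 k) (by linarith)).add
        (posSemidef_ofReal_smul (hY k) ht.le), ?_, ?_⟩
      · rw [htr]; nlinarith [hQ.2.1]
      · rw [htr]; nlinarith [hQ.2.2]
    -- Along a segment in the convex feasible set the rate never exceeds its maximum, so the
    -- directional derivative is at most `0`.
    have h := sum_rateGradient_le_of_forall (D := Y - Q) (c := 0) hw hQ.1
      (fun t ht ht1 => (hmem t ht ht1).1)
      (fun t ht ht1 => by rw [mul_zero, add_zero]; exact hmax (hmem t ht ht1))
    have h' : tracePairing (rateGradient H w π Q) (Y - Q) ≤ 0 := h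
    rw [map_sub] at h'
    linarith
  obtain ⟨l₁, l₂, hl₁, hl₂, hle, heq, heq'⟩ := exists_lagrange_multipliers
    (C := {Y : Fin K → Matrix (Fin Nt) (Fin Nt) ℂ | ∀ k, (Y k).PosSemidef})
    (by
      intro Y hY Z hZ a b ha hb _ k
      have := (posSemidef_ofReal_smul (hY k) ha).add (posSemidef_ofReal_smul (hZ k) hb)
      simpa only [Complex.coe_smul, Pi.add_apply, Pi.smul_apply] using this)
    (fun _ => PosSemidef.zero)
    (fun t ht Y hY k => by
      have := posSemidef_ofReal_smul (hY k) ht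
      simpa only [Complex.coe_smul, Pi.add_apply, Pi.smul_apply] using this)
    (tracePairing (rateGradient H w π Q)) (tracePairing fun _ => A₁) (tracePairing fun _ => A₂)
    hP₁ hP₂ (q := Q) hQ.1 (by rw [tracePairing_const]; exact hQ.2.1)
    (by rw [tracePairing_const]; exact hQ.2.2) hlin
  have htr : ∀ Y : Fin K → Matrix (Fin Nt) (Fin Nt) ℂ,
      ((∑ k, Y k) * ((l₁ : ℂ) • A₁ + (l₂ : ℂ) • A₂)).trace.re
      = l₁ * tracePairing (fun _ => A₁) Y + l₂ * tracePairing (fun _ => A₂) Y := by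
    intro Y
    rw [tracePairing_const, tracePairing_const, Matrix.mul_add, trace_add, Complex.add_re,
      Matrix.mul_smul, Matrix.mul_smul, re_trace_smul, re_trace_smul]
  refine ⟨Q, hQ, l₁, l₂, hl₁, hl₂, isRateStationary_of_forall hw
    ((posSemidef_ofReal_smul hA₁ hl₁).add (posSemidef_ofReal_smul hA₂ hl₂)).1 hQ.1 ?_ ?_, ?_⟩
  · intro Y hY
    rw [htr]
    exact hle Y hY
  · rw [htr, heq']
    exact heq.ge
  · rw [htr, heq']

/-- Strong duality for an order in which the weights decrease. -/
theorem exists_bcOptimum_le_orderOptimum (hw : ∀ i, 0 < w i) (hA₁ : A₁.PosSemidef)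
    (hA₂ : A₂.PosSemidef) (hP₁ : 0 < P₁) (hP₂ : 0 < P₂)
    (hπ : ∀ i j, π i ≤ π j → w j ≤ w i) :
    (∃ l₁ l₂ : ℝ, 0 ≤ l₁ ∧ 0 ≤ l₂ ∧ bcOptimum H w (aggregatedConstraint A₁ A₂ P₁ P₂ l₁ l₂)
      ≤ orderOptimum H w π (twoConstraints A₁ A₂ P₁ P₂)) ∧
    (orderOptimum H w π (twoConstraints A₁ A₂ P₁ P₂) ≠ ⊤ →
      ∃ Q ∈ feasible K (twoConstraints A₁ A₂ P₁ P₂),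
        (weightedSumRate H w π Q : EReal)
          = orderOptimum H w π (twoConstraints A₁ A₂ P₁ P₂)) := by
  by_cases hker : ∀ v : Fin Nt → ℂ, (A₁ + A₂) *ᵥ v = 0 → ∀ i, H i *ᵥ v = 0
  swap
  · push Not at hker
    obtain ⟨v, hv, i, hi⟩ := hker
    have htop := orderOptimum_eq_top (π := π) hw hA₁ hA₂ hP₁ hP₂ hv hi
    exact ⟨⟨0, 0, le_rfl, le_rfl, htop ▸ le_top⟩, fun h => absurd htop h⟩
  obtain ⟨p, hp, hpp, hAp, hp1, hpA⟩ := (hA₁.add hA₂).exists_support_projection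
  have hH : ∀ k, H k * p = H k := fun k => mul_eq_self_of_ker_le hAp fun v hv => hker v hv k
  have hproj : ∀ B : Matrix (Fin Nt) (Fin Nt) ℂ, B.PosSemidef →
      (∀ v, (A₁ + A₂) *ᵥ v = 0 → B *ᵥ v = 0) → p * B * p = B := by
    intro B hB h
    have h1 := mul_eq_self_of_ker_le hAp h
    have h2 := congrArg conjTranspose h1
    rw [conjTranspose_mul, hp.eq, hB.1.eq] at h2
    rw [h2, h1]
  have hp₁ := hproj A₁ hA₁ fun v hv => hA₁.mulVec_eq_zero_of_add hA₂ hv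
  have hp₂ := hproj A₂ hA₂ fun v hv => hA₂.mulVec_eq_zero_of_add hA₁ (by rwa [add_comm])
  have hB : (A₁ + (1 - p) + A₂).PosDef := by
    rwa [add_right_comm]
  -- Replacing `A₁` by `A₁ + (1 - p)` penalizes only directions that no user sees. It tightens the
  -- first constraint, so its optimizer stays feasible for the original problem.
  obtain ⟨Q, hQ, l₁, l₂, hl₁, hl₂, hst, htr⟩ := exists_isRateStationary_of_posDef_add (H := H)
    (w := w) (π := π) (P₁ := P₁) (P₂ := P₂) (fun i => (hw i).le) (hA₁.add hp1) hA₂ hB hP₁ hP₂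
  have hQ' : Q ∈ feasible K (twoConstraints A₁ A₂ P₁ P₂) := by
    refine ⟨hQ.1, le_trans ?_ hQ.2.1, hQ.2.2⟩
    rw [Matrix.mul_add, trace_add, Complex.add_re, le_add_iff_nonneg_right]
    exact (posSemidef_sum _ fun j _ => hQ.1 j).re_trace_mul_nonneg hp1
  have hbound : ∀ (π' : Equiv.Perm (Fin K)),
      ∀ Y ∈ feasible K (aggregatedConstraint A₁ A₂ P₁ P₂ l₁ l₂),
      weightedSumRate H w π' Y ≤ weightedSumRate H w π Q := by
    intro π' Y hY
    -- A competitor `Y` is compared through `p * Y k * p`, which has the same rates, the same traces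
    -- against `A₁` and `A₂`, and no cost from `1 - p`.
    have h := hst.lagrangian_le hw hπ ((posSemidef_ofReal_smul (hA₁.add hp1) hl₁).add
      (posSemidef_ofReal_smul hA₂ hl₂)) π' (posSemidef_conj hp hY.1)
    have h0 : (∑ k, p * Y k * p) * (1 - p) = 0 := by
      rw [← Finset.sum_mul, Matrix.mul_assoc, Matrix.mul_sub, Matrix.mul_one, hpp, sub_self,
        Matrix.mul_zero]
    rw [htr, weightedSumRate_conj hp hH, Matrix.mul_add, Matrix.mul_smul, Matrix.mul_smul,
      Matrix.mul_add, h0, add_zero, trace_add, Complex.add_re, re_trace_smul, re_trace_smul,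
      trace_sum_conj_mul hp₁, trace_sum_conj_mul hp₂] at h
    have hY2 : l₁ * ((∑ k, Y k) * A₁).trace.re + l₂ * ((∑ k, Y k) * A₂).trace.re
        ≤ l₁ * P₁ + l₂ * P₂ := hY.2
    linarith
  have hle : bcOptimum H w (aggregatedConstraint A₁ A₂ P₁ P₂ l₁ l₂) ≤ weightedSumRate H w π Q :=
    iSup_le fun π' => iSup₂_le fun Y hY => EReal.coe_le_coe_iff.mpr (hbound π' Y hY)
  have hge : (weightedSumRate H w π Q : EReal)
      ≤ orderOptimum H w π (twoConstraints A₁ A₂ P₁ P₂) :=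
    le_iSup₂ (f := fun Q _ => (weightedSumRate H w π Q : EReal)) Q hQ'
  refine ⟨⟨l₁, l₂, hl₁, hl₂, hle.trans hge⟩, fun _ => ⟨Q, hQ', le_antisymm hge ?_⟩⟩
  exact (orderOptimum_mono (twoConstraints_subset hl₁ hl₂)).trans
    ((orderOptimum_le_bcOptimum _).trans hle)

theorem exists_perm_antitone (w : Fin K → ℝ) :
    ∃ π : Equiv.Perm (Fin K), ∀ i j, π i ≤ π j → w j ≤ w i := by
  -- Sorting maps positions to users, whereas an encoding order maps users to positions, hence the
  -- inverse.
  refine ⟨(Tuple.sort fun i => -w i).symm, fun i j h => ?_⟩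
  have := Tuple.monotone_sort (fun i => -w i) h
  simpa using this

end Optimum

end

theorem proposition4 {K Nt Nr : ℕ} (H : Fin K → Matrix (Fin Nr) (Fin Nt) ℂ)
    (w : Fin K → ℝ) (hw : ∀ i, 0 < w i)
    (A₁ A₂ : Matrix (Fin Nt) (Fin Nt) ℂ) (hA₁ : A₁.PosSemidef) (hA₂ : A₂.PosSemidef)
    (P₁ P₂ : ℝ) (hP₁ : 0 < P₁) (hP₂ : 0 < P₂) :
    (IsLeast
        {x : EReal | ∃ l₁ l₂ : ℝ, 0 ≤ l₁ ∧ 0 ≤ l₂ ∧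
          x = bcOptimum H w (aggregatedConstraint A₁ A₂ P₁ P₂ l₁ l₂)}
        (bcOptimum H w (twoConstraints A₁ A₂ P₁ P₂)) ∧
      (bcOptimum H w (twoConstraints A₁ A₂ P₁ P₂) ≠ ⊤ →
        ∃ π : Equiv.Perm (Fin K), ∃ Q ∈ feasible K (twoConstraints A₁ A₂ P₁ P₂),
          (weightedSumRate H w π Q : EReal) =
            bcOptimum H w (twoConstraints A₁ A₂ P₁ P₂))) ∧
    ∀ π : Equiv.Perm (Fin K), (∀ i j, π i ≤ π j → w j ≤ w i) →
      IsLeast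
        {x : EReal | ∃ l₁ l₂ : ℝ, 0 ≤ l₁ ∧ 0 ≤ l₂ ∧
          x = orderOptimum H w π (aggregatedConstraint A₁ A₂ P₁ P₂ l₁ l₂)}
        (orderOptimum H w π (twoConstraints A₁ A₂ P₁ P₂)) ∧
      (orderOptimum H w π (twoConstraints A₁ A₂ P₁ P₂) ≠ ⊤ →
        ∃ Q ∈ feasible K (twoConstraints A₁ A₂ P₁ P₂),
          (weightedSumRate H w π Q : EReal) =
            orderOptimum H w π (twoConstraints A₁ A₂ P₁ P₂)) := by
  refine ⟨?_, fun π hπ => ?_⟩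
  · obtain ⟨π, hπ⟩ := exists_perm_antitone w
    obtain ⟨⟨l₁, l₂, hl₁, hl₂, hle⟩, hatt⟩ :=
      exists_bcOptimum_le_orderOptimum (H := H) hw hA₁ hA₂ hP₁ hP₂ hπ
    -- The bound on `g` already covers all encoding orders, so a single order of nonincreasing
    -- weights attains the optimum over orders.
    have heq : orderOptimum H w π (twoConstraints A₁ A₂ P₁ P₂)
        = bcOptimum H w (twoConstraints A₁ A₂ P₁ P₂) :=
      le_antisymm (orderOptimum_le_bcOptimum _)
        ((bcOptimum_mono (twoConstraints_subset hl₁ hl₂)).trans hle)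
    refine ⟨⟨⟨l₁, l₂, hl₁, hl₂, le_antisymm (bcOptimum_mono (twoConstraints_subset hl₁ hl₂))
      (heq ▸ hle)⟩, ?_⟩, fun h => ?_⟩
    · rintro x ⟨m₁, m₂, hm₁, hm₂, rfl⟩
      exact bcOptimum_mono (twoConstraints_subset hm₁ hm₂)
    · rw [← heq] at h ⊢
      exact ⟨π, hatt h⟩
  · obtain ⟨⟨l₁, l₂, hl₁, hl₂, hle⟩, hatt⟩ :=
      exists_bcOptimum_le_orderOptimum (H := H) hw hA₁ hA₂ hP₁ hP₂ hπ
    refine ⟨⟨⟨l₁, l₂, hl₁, hl₂, le_antisymm (orderOptimum_mono (twoConstraints_subset hl₁ hl₂))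
      ((orderOptimum_le_bcOptimum _).trans hle)⟩, ?_⟩, hatt⟩
    rintro x ⟨m₁, m₂, hm₁, hm₂, rfl⟩
    exact orderOptimum_mono (twoConstraints_subset hm₁ hm₂)
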